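/- Let $\widehat c$ be the space of real sequences with only finitely many nonzero terms. A symmetric norming function is a norm $\Phi$ on $\widehat c$ with $\Phi(1,0,0,\dots)=1$ and $\Phi(\{\xi_j\})=\Phi(\{|\xi_{\theta(j)}|\})$ for every bijection $\theta$ of $\mathbb N$ and every $\xi\in\widehat c$. It is extended to all real sequences by $\Phi(\xi)=\lim_{m\to\infty}\Phi(\xi_1,\dots,\xi_m,0,0,\dots)\in[0,\infty]$. Two symmetric norming functions $\Phi,\Psi$ are equivalent, $\Phi\sim\Psi$, if $\Phi/\Psi$ and $\Psi/\Phi$ are bounded on $\widehat c\setminus\{0\}$; write $\Phi_\infty(\xi)=\sup_j|\xi_j|$. Let $\mathcal H$ be a separable complex Hilbert space. For a bounded operator $T\ge 0$ on $\mathcal H$ with $\eta=\sup\sigma(T)$, the numbers $\lambda_1(T)\ge\lambda_2(T)\ge\cdots$ are defined as follows. If $\eta$ is an accumulation point of $\sigma(T)$ or an eigenvalue of infinite multiplicity, then $\lambda_j(T)=\eta$ for all $j$. Otherwise $\eta$ is an eigenvalue of finite multiplicity $p$; then $\lambda_j(T)=\eta$ for $j\le p$ and $\lambda_{p+j}(T)=\lambda_j(T-\eta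 P)$ for $j\ge1$, where $P$ is the orthogonal projection onto the eigenspace of $\eta$. (All $\lambda_j$ are $0$ if $\mathcal H=\{0\}$.) For a bounded operator $A$ put $|A|=(A^*A)^{1/2}$, $s_j(A)=\lambda_j(|A|)$ and $|A|_\Phi=\Phi(\{s_j(A)\}_{j=1}^\infty)\in[0,\infty]$. **Proposition.** For every symmetric norming function $\Phi$ there is a constant $C>0$, depending only on $\Phi$, with $C=1$ if $\Phi\not\sim\Phi_\infty$, such that for every separable complex Hilbert space $\mathcal H$, every $0<s\le 1$ and every sequence $\{H_j\}_{j=1}^\infty$ of bounded operators on $\mathcal H$, $$\Bigl|\,\Bigl|\sum_{j=1}^\infty H_j\Bigr|^s\Bigr|_\Phi\le C\,2^{1-s}\sum_{j=1}^\infty\bigl|\,|H_j|^s\bigr|_\Phi .$$ Here, if the right-hand side is finite, then $\sum_j\|H_j\|<\infty$, so that $\sum_j H_j$ converges in operator norm; if the right-hand side is infinite, the inequality holds trivially. -/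

import Mathlib

open scoped ENNReal Topology

noncomputable section

/-- A symmetric norming function: a norm `Φ` on the space `ℕ →₀ ℝ` of finitely supported real
sequences with `Φ (1, 0, 0, …) = 1` that does not change when the entries are permuted and
replaced by their absolute values. (A `Seminorm` is nonnegative, subadditive and absolutely
homogeneous; `definite` makes it a norm.) -/
structure SymmetricNormingFunction extends Seminorm ℝ (ℕ →₀ ℝ) where
  definite : ∀ ξ : ℕ →₀ ℝ, toFun ξ = 0 → ξ = 0
  normalized : toFun (Finsupp.single 0 1) = 1
  symmetric : ∀ (θ : Equiv.Perm ℕ) (ξ η : ℕ →₀ ℝ), (∀ j, η j = |ξ (θ j)|) → toFun ξ = toFun η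

namespace SymmetricNormingFunction

/-- The extension of `Φ` to all real sequences, with values in `[0, ∞]`: the limit as `m → ∞`,
that is, the supremum over `m`, of the nondecreasing sequence `Φ (ξ₀, …, ξ_{m-1}, 0, 0, …)`. -/
def extend (Φ : SymmetricNormingFunction) (ξ : ℕ → ℝ) : ℝ≥0∞ :=
  ⨆ m : ℕ, ENNReal.ofReal (Φ.toFun (Finsupp.indicator (Finset.range m) fun j _ => ξ j))

/-- Equivalence of symmetric norming functions: both quotients `Φ ξ / Ψ ξ` and `Ψ ξ / Φ ξ` are
bounded above over the nonzero finitely supported sequences `ξ`. -/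
def Equivalent (Φ Ψ : SymmetricNormingFunction) : Prop :=
  BddAbove {r : ℝ | ∃ ξ : ℕ →₀ ℝ, ξ ≠ 0 ∧ r = Φ.toFun ξ / Ψ.toFun ξ} ∧
    BddAbove {r : ℝ | ∃ ξ : ℕ →₀ ℝ, ξ ≠ 0 ∧ r = Ψ.toFun ξ / Φ.toFun ξ}

theorem bddAbove_abs (ξ : ℕ →₀ ℝ) : BddAbove (Set.range fun j => |ξ j|) := by
  have h : (Set.range fun j => |ξ j|) ⊆ (fun x : ℝ => |x|) '' Set.range ξ := by
    rintro _ ⟨j, rfl⟩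
    exact ⟨ξ j, ⟨j, rfl⟩, rfl⟩
  exact ((ξ.finite_range.image _).subset h).bddAbove

/-- The symmetric norming function `Φ_∞ ξ = sup_j |ξ j|`. -/
def sup : SymmetricNormingFunction where
  toFun ξ := ⨆ j, |ξ j|
  map_zero' := by simp
  add_le' ξ η := ciSup_le fun j => (abs_add_le (ξ j) (η j)).trans
    (add_le_add (le_ciSup (bddAbove_abs ξ) j) (le_ciSup (bddAbove_abs η) j))
  neg' ξ := by simp
  smul' a ξ := by
    simp only [Finsupp.smul_apply, smul_eq_mul, abs_mul, Real.norm_eq_abs]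
    exact (Real.mul_iSup_of_nonneg (abs_nonneg a) _).symm
  definite ξ h := by
    ext j
    have h1 : |ξ j| ≤ ⨆ j, |ξ j| := le_ciSup (bddAbove_abs ξ) j
    have h2 : (⨆ j, |ξ j|) = 0 := h
    simpa using h1.trans h2.le
  normalized := by
    apply le_antisymm
    · refine ciSup_le fun j => ?_
      by_cases h : j = 0 <;> simp [h]
    · have := le_ciSup (bddAbove_abs (Finsupp.single 0 1)) 0
      simpa using this
  symmetric θ ξ η h := by
    simp only [h, abs_abs]
    exact (θ.surjective.iSup_comp fun j => |ξ j|).symm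

end SymmetricNormingFunction

section SNumbers

variable {H : Type*} [NormedAddCommGroup H] [InnerProductSpace ℂ H] [CompleteSpace H]

/-- The eigenspace of `T` for the real number `η` (it is `⊥` if `η` is not an eigenvalue). -/
def realEigenspace (T : H →L[ℂ] H) (η : ℝ) : Submodule ℂ H :=
  Module.End.eigenspace (T : H →ₗ[ℂ] H) (η : ℂ)

instance completeSpace_realEigenspace (T : H →L[ℂ] H) (η : ℝ) :
    CompleteSpace (realEigenspace T η) := by
  have h : (realEigenspace T η : Set H) = {x | T x = (η : ℂ) • x} := by
    ext x
    simp [realEigenspace]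
  have hc : IsClosed (realEigenspace T η : Set H) := by
    rw [h]
    exact isClosed_eq T.continuous (continuous_const_smul _)
  exact hc.completeSpace_coe

/-- The condensed spectrum of a self-adjoint operator `T`: the points of the spectrum that are
accumulation points of the spectrum or eigenvalues of infinite multiplicity. -/
def condensedSpectrum (T : H →L[ℂ] H) : Set ℝ :=
  {η ∈ spectrum ℝ T | AccPt η (Filter.principal (spectrum ℝ T)) ∨
    ¬ FiniteDimensional ℂ (realEigenspace T η)}

/-- The top `sup σ(T)` of the spectrum of a positive operator `T`. -/
def specTop (T : H →L[ℂ] H) : ℝ := sSup (spectrum ℝ T)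

/-- The multiplicity of `sup σ(T)` as an eigenvalue of `T`. -/
def topMult (T : H →L[ℂ] H) : ℕ := Module.finrank ℂ (realEigenspace T (specTop T))

/-- The operator `T - η P`, where `η = sup σ(T)` and `P` is the orthogonal projection onto the
eigenspace of `T` for `η`. -/
def deflate (T : H →L[ℂ] H) : H →L[ℂ] H :=
  T - (specTop T : ℂ) • (realEigenspace T (specTop T)).starProjection

open Classical in
/-- The numbers `λ_j(T)` of a positive operator `T`, indexed from `j = 0`. Let `η = sup σ(T)`.
If `η` is in the condensed spectrum of `T`, then `λ_j(T) = η` for all `j`. Otherwise `η` is an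
eigenvalue of finite multiplicity `p`, and `λ_j(T) = η` for `j < p`, `λ_{p+j}(T) = λ_j(T - η P)`.
(For a positive operator the case `p = 0` outside the condensed spectrum arises on the zero space
only; there the value is `sSup ∅ = 0`.) -/
def lambdaNumber (T : H →L[ℂ] H) (j : ℕ) : ℝ :=
  if specTop T ∈ condensedSpectrum T ∨ topMult T = 0 ∨ j < topMult T then specTop T
  else lambdaNumber (deflate T) (j - topMult T)
termination_by j
decreasing_by
  simp only [not_or, not_lt] at *
  omega

/-- The s-numbers `s_j(A) = λ_j((A⋆A)^{1/2})`, indexed from `j = 0`. -/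
def sNumber (A : H →L[ℂ] H) (j : ℕ) : ℝ := lambdaNumber (CFC.abs A) j

/-- `|A|_Φ = Φ (s₀(A), s₁(A), …)`, with values in `[0, ∞]`; it is finite exactly when `A` lies in
the symmetrically-normed ideal of `Φ`. -/
def SymmetricNormingFunction.opNorm (Φ : SymmetricNormingFunction) (A : H →L[ℂ] H) : ℝ≥0∞ :=
  Φ.extend (sNumber A)

end SNumbers

end

/-! ### Gelfand numbers and compactness -/

section GelfandNumbers

open Module Submodule

variable {H : Type*} [NormedAddCommGroup H] [InnerProductSpace ℂ H]

/-! The s-numbers are replaced by the Gelfand numbers c_j(A), the infimum of the norms of A on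
orthogonal complements of subspaces of dimension at most j. They depend only on the function ‖A x‖,
so A and |A| share them, and `lambdaNumber_eq_gelfandNumber` is the min-max principle for positive
operators.

If Φ is not equivalent to Φ_∞, then Φ(1,…,1,0,…) is unbounded in the number of ones, so finiteness
of Φ on a decreasing nonnegative sequence makes it tend to 0. Hence every term of the series is
compact, c_i(|A|^s) = c_i(A)^s, and Rotfel'd's inequality bounds the sum over i < k of c_i(A+B)^s by
the sum over i < k of c_i(A)^s + c_i(B)^s. A norm limit extends this to series. The s-th powers of
the c_i of the sum are thus weakly majorized by the sums of the s-th powers, and Ky Fan dominance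
together with the countable triangle inequality for Φ gives the claim.

Rotfel'd's inequality rests on x^s being, up to a linear term, a positive mixture of the truncations
min(x,t). For truncations it follows from a bound on tail sums: remove the leading p singular
directions of A and q of B, and apply Ky Fan's inequality to what remains
(`sum_Ico_gelfandNumber_add_le`).

If Φ is equivalent to Φ_∞, the terms need not be compact, but Φ is at most a multiple of Φ_∞, and
subadditivity of x^s applied to operator norms suffices. In both cases the factor 2^(1-s) ≥ 1 is
pure slack. -/

/-- `‖A x‖ ≤ t ‖x‖` on the orthogonal complement of a subspace of dimension at most `j`. -/
def IsGelfandBound (A : H →L[ℂ] H) (j : ℕ) (t : ℝ) : Prop :=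
  0 ≤ t ∧ ∃ V : Submodule ℂ H, FiniteDimensional ℂ V ∧ finrank ℂ V ≤ j ∧
    ∀ x ∈ Vᗮ, ‖A x‖ ≤ t * ‖x‖

/-- The Gelfand numbers of an operator, indexed from `0`. -/
noncomputable def gelfandNumber (A : H →L[ℂ] H) (j : ℕ) : ℝ := sInf {t | IsGelfandBound A j t}

theorem IsGelfandBound.mono {A : H →L[ℂ] H} {i j : ℕ} {s t : ℝ} (h : IsGelfandBound A i s)
    (hij : i ≤ j) (hst : s ≤ t) : IsGelfandBound A j t := by
  obtain ⟨h0, V, hV, hVi, hb⟩ := h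
  exact ⟨h0.trans hst, V, hV, hVi.trans hij,
    fun x hx => (hb x hx).trans (by gcongr)⟩

theorem isGelfandBound_norm (A : H →L[ℂ] H) (j : ℕ) : IsGelfandBound A j ‖A‖ :=
  ⟨norm_nonneg _, ⊥, inferInstance, by simp, fun x _ => A.le_opNorm x⟩

theorem gelfandNumber_le {A : H →L[ℂ] H} {j : ℕ} {t : ℝ} (h : IsGelfandBound A j t) :
    gelfandNumber A j ≤ t :=
  csInf_le ⟨0, fun _ h => h.1⟩ h

theorem gelfandNumber_nonneg (A : H →L[ℂ] H) (j : ℕ) : 0 ≤ gelfandNumber A j :=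
  le_csInf ⟨_, isGelfandBound_norm A j⟩ fun _ h => h.1

theorem isGelfandBound_of_lt {A : H →L[ℂ] H} {j : ℕ} {t : ℝ} (h : gelfandNumber A j < t) :
    IsGelfandBound A j t := by
  obtain ⟨s, hs, hst⟩ := exists_lt_of_csInf_lt
    (show Set.Nonempty {t | IsGelfandBound A j t} from ⟨_, isGelfandBound_norm A j⟩) h
  exact hs.mono le_rfl hst.le

theorem le_gelfandNumber {A : H →L[ℂ] H} {j : ℕ} {a : ℝ}
    (h : ∀ t, IsGelfandBound A j t → a ≤ t) : a ≤ gelfandNumber A j :=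
  le_csInf ⟨_, isGelfandBound_norm A j⟩ h

theorem gelfandNumber_antitone (A : H →L[ℂ] H) : Antitone (gelfandNumber A) := fun _ _ hij =>
  le_gelfandNumber fun _ ht => gelfandNumber_le (ht.mono hij le_rfl)

theorem gelfandNumber_le_norm (A : H →L[ℂ] H) (j : ℕ) : gelfandNumber A j ≤ ‖A‖ :=
  gelfandNumber_le (isGelfandBound_norm A j)

theorem gelfandNumber_zero (A : H →L[ℂ] H) : gelfandNumber A 0 = ‖A‖ := by
  refine le_antisymm (gelfandNumber_le_norm A 0) (le_gelfandNumber ?_)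
  rintro t ⟨h0, V, hV, hV0, hb⟩
  have hbot : V = ⊥ := Submodule.finrank_eq_zero.1 (Nat.le_zero.1 hV0)
  exact A.opNorm_le_bound h0 fun x => hb x (by simp [hbot])

/-- Dimension count: the orthogonal projection onto V cannot be injective on W. The conditional
hypothesis also admits W of infinite dimension. -/
theorem exists_ne_zero_mem_orthogonal (W V : Submodule ℂ H) [FiniteDimensional ℂ V]
    (h : FiniteDimensional ℂ W → finrank ℂ V < finrank ℂ W) : ∃ x ∈ W, x ∈ Vᗮ ∧ x ≠ 0 := by
  let f : W →ₗ[ℂ] V := (V.orthogonalProjectionOnto : H →ₗ[ℂ] V) ∘ₗ W.subtype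
  have hf : ¬ Function.Injective f := fun hinj => by
    have hW : FiniteDimensional ℂ W := FiniteDimensional.of_injective f hinj
    exact (h hW).not_ge (LinearMap.finrank_le_finrank_of_injective hinj)
  rw [← LinearMap.ker_eq_bot, Submodule.eq_bot_iff] at hf
  push Not at hf
  obtain ⟨x, hx, hx0⟩ := hf
  refine ⟨x, x.2, ?_, by simpa using hx0⟩
  rw [← orthogonalProjectionOnto_eq_zero_iff]
  exact hx

/-- The lower half of min-max: every competing complement meets W in a nonzero vector. -/
theorem le_gelfandNumber_of_subspace {A : H →L[ℂ] H} {j : ℕ} {a : ℝ} (W : Submodule ℂ H)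
    (hW : FiniteDimensional ℂ W → j < finrank ℂ W) (h : ∀ x ∈ W, a * ‖x‖ ≤ ‖A x‖) :
    a ≤ gelfandNumber A j := by
  refine le_gelfandNumber ?_
  rintro t ⟨h0, V, hV, hVj, hb⟩
  obtain ⟨x, hxW, hxV, hx0⟩ := exists_ne_zero_mem_orthogonal W V fun h => hVj.trans_lt (hW h)
  exact le_of_mul_le_mul_right ((h x hxW).trans (hb x hxV)) (norm_pos_iff.2 hx0)

theorem gelfandNumber_le_of_norm_le {A B : H →L[ℂ] H} {a : ℝ} (ha : 0 ≤ a)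
    (h : ∀ x, ‖A x‖ ≤ a * ‖B x‖) (j : ℕ) : gelfandNumber A j ≤ a * gelfandNumber B j := by
  refine le_of_forall_pos_le_add fun ε hε => ?_
  obtain ⟨h0, V, hV, hVj, hb⟩ := isGelfandBound_of_lt
    (show gelfandNumber B j < gelfandNumber B j + ε / (a + 1) by
      have : 0 < ε / (a + 1) := by positivity
      linarith)
  have h1 : gelfandNumber A j ≤ a * (gelfandNumber B j + ε / (a + 1)) := by
    refine gelfandNumber_le ⟨by positivity, V, hV, hVj, fun x hx => (h x).trans ?_⟩
    rw [mul_assoc]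
    exact mul_le_mul_of_nonneg_left (hb x hx) ha
  have h2 : a * (ε / (a + 1)) ≤ ε := by
    rw [mul_div_assoc', div_le_iff₀ (by positivity)]
    nlinarith
  linarith

theorem gelfandNumber_congr {A B : H →L[ℂ] H} (h : ∀ x, ‖A x‖ = ‖B x‖) :
    gelfandNumber A = gelfandNumber B := by
  have : IsGelfandBound A = IsGelfandBound B := by
    funext j t
    simp only [IsGelfandBound, h]
  funext j
  rw [gelfandNumber, gelfandNumber, this]

/-- A subspace competing for D becomes one for A after V is added to it. -/
theorem gelfandNumber_add_le_of_eqOn {A D : H →L[ℂ] H} {j n : ℕ} (V : Submodule ℂ H)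
    [FiniteDimensional ℂ V] (hV : finrank ℂ V ≤ n) (h : ∀ x ∈ Vᗮ, D x = A x) :
    gelfandNumber A (j + n) ≤ gelfandNumber D j := by
  refine le_gelfandNumber ?_
  rintro t ⟨h0, W, hW, hWj, hb⟩
  refine gelfandNumber_le ⟨h0, W ⊔ V, inferInstance,
    (Submodule.finrank_add_le_finrank_add_finrank W V).trans (add_le_add hWj hV), fun x hx => ?_⟩
  rw [← h x (orthogonal_le le_sup_right hx)]
  exact hb x (orthogonal_le le_sup_left hx)

theorem gelfandNumber_add_le (A B : H →L[ℂ] H) (i j : ℕ) :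
    gelfandNumber (A + B) (i + j) ≤ gelfandNumber A i + gelfandNumber B j := by
  refine le_of_forall_pos_le_add fun ε hε => ?_
  obtain ⟨h0, V, hV, hVi, hb⟩ := isGelfandBound_of_lt
    (show gelfandNumber A i < gelfandNumber A i + ε / 2 by linarith)
  obtain ⟨h0', W, hW, hWj, hb'⟩ := isGelfandBound_of_lt
    (show gelfandNumber B j < gelfandNumber B j + ε / 2 by linarith)
  have : gelfandNumber (A + B) (i + j) ≤
      (gelfandNumber A i + ε / 2) + (gelfandNumber B j + ε / 2) := by
    refine gelfandNumber_le ⟨add_nonneg h0 h0', V ⊔ W, inferInstance,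
      (Submodule.finrank_add_le_finrank_add_finrank V W).trans (add_le_add hVi hWj),
      fun x hx => ?_⟩
    rw [add_mul]
    exact (norm_add_le _ _).trans (add_le_add (hb x (orthogonal_le le_sup_left hx))
      (hb' x (orthogonal_le le_sup_right hx)))
  linarith

/-- Operators whose Gelfand numbers tend to `0`, that is, compact operators. -/
def GelfandCompact (A : H →L[ℂ] H) : Prop :=
  Filter.Tendsto (gelfandNumber A) Filter.atTop (𝓝 0)

theorem gelfandCompact_iff {A : H →L[ℂ] H} :
    GelfandCompact A ↔ ∀ ε > 0, ∃ j, gelfandNumber A j < ε := by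
  rw [GelfandCompact, Metric.tendsto_atTop]
  refine forall₂_congr fun ε hε => ⟨fun ⟨j, h⟩ => ⟨j, ?_⟩, fun ⟨j, h⟩ => ⟨j, fun n hn => ?_⟩⟩
  · simpa [abs_of_nonneg (gelfandNumber_nonneg A j)] using h j le_rfl
  · simpa [abs_of_nonneg (gelfandNumber_nonneg A n)] using
      (gelfandNumber_antitone A hn).trans_lt h

theorem GelfandCompact.of_le {A B : H →L[ℂ] H} (hB : GelfandCompact B) {a : ℝ}
    (h : ∀ j, gelfandNumber A j ≤ a * gelfandNumber B j) : GelfandCompact A :=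
  squeeze_zero (gelfandNumber_nonneg A) h (by simpa using hB.const_mul a)

theorem GelfandCompact.add {A B : H →L[ℂ] H} (hA : GelfandCompact A) (hB : GelfandCompact B) :
    GelfandCompact (A + B) := by
  rw [gelfandCompact_iff] at *
  intro ε hε
  obtain ⟨i, hi⟩ := hA (ε / 2) (by linarith)
  obtain ⟨j, hj⟩ := hB (ε / 2) (by linarith)
  exact ⟨i + j, (gelfandNumber_add_le A B i j).trans_lt (by linarith)⟩

theorem gelfandCompact_zero : GelfandCompact (0 : H →L[ℂ] H) := by
  rw [gelfandCompact_iff]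
  intro ε hε
  exact ⟨0, by simpa [gelfandNumber_zero] using hε⟩

theorem GelfandCompact.sum {ι : Type*} (s : Finset ι) {A : ι → H →L[ℂ] H}
    (hA : ∀ i ∈ s, GelfandCompact (A i)) : GelfandCompact (∑ i ∈ s, A i) :=
  Finset.sum_induction _ GelfandCompact (fun _ _ => GelfandCompact.add) gelfandCompact_zero hA

theorem gelfandCompact_tsum {A : ℕ → H →L[ℂ] H} (hs : Summable A)
    (hA : ∀ i, GelfandCompact (A i)) : GelfandCompact (∑' i, A i) := by
  rw [gelfandCompact_iff]
  intro ε hε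
  obtain ⟨N, hN⟩ := (Metric.tendsto_atTop.1 hs.hasSum.tendsto_sum_nat) (ε / 2) (by linarith)
  have hN := hN N le_rfl
  rw [dist_eq_norm, norm_sub_rev] at hN
  obtain ⟨j, hj⟩ := gelfandCompact_iff.1
    (GelfandCompact.sum (Finset.range N) fun i _ => hA i) (ε / 2) (by linarith)
  refine ⟨j + 0, ?_⟩
  have := gelfandNumber_add_le (∑ i ∈ Finset.range N, A i)
    (∑' i, A i - ∑ i ∈ Finset.range N, A i) j 0
  rw [add_sub_cancel, gelfandNumber_zero] at this
  linarith

variable [CompleteSpace H]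

/-- If x is orthogonal to the image of V under the adjoint of B, then B x is orthogonal to V, and
that image is no larger than V. -/
theorem gelfandNumber_mul_le (A B : H →L[ℂ] H) (hB : ‖B‖ ≤ 1) (j : ℕ) :
    gelfandNumber (A * B) j ≤ gelfandNumber A j := by
  refine le_gelfandNumber ?_
  rintro t ⟨h0, V, hV, hVj, hb⟩
  refine gelfandNumber_le ⟨h0, V.map (B.adjoint : H →ₗ[ℂ] H), inferInstance,
    (Submodule.finrank_map_le _ _).trans hVj, fun x hx => ?_⟩
  have hBx : B x ∈ Vᗮ := by
    rw [mem_orthogonal]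
    intro v hv
    rw [← ContinuousLinearMap.adjoint_inner_left]
    exact (mem_orthogonal _ _).1 hx _ ⟨v, hv, rfl⟩
  refine (hb _ hBx).trans (mul_le_mul_of_nonneg_left ?_ h0)
  simpa using B.le_of_opNorm_le hB x

theorem GelfandCompact.mul_right {A : H →L[ℂ] H} (hA : GelfandCompact A) (B : H →L[ℂ] H)
    (hB : ‖B‖ ≤ 1) : GelfandCompact (A * B) :=
  hA.of_le (a := 1) fun j => by simpa using gelfandNumber_mul_le A B hB j

end GelfandNumbers

/-! ### Norm estimates from the functional calculus -/

section PositiveOperators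

open Module Submodule

variable {H : Type*} [NormedAddCommGroup H] [InnerProductSpace ℂ H] [CompleteSpace H]

theorem inner_cfc_cfc {T : H →L[ℂ] H} {f g : ℝ → ℝ}
    (hf : ContinuousOn f (spectrum ℝ T)) (hg : ContinuousOn g (spectrum ℝ T)) (x y : H) :
    inner ℂ (cfc f T x) (cfc g T y) = inner ℂ x (cfc (fun r => f r * g r) T y) := by
  have hsa : IsSelfAdjoint (cfc f T) := cfc_predicate f T
  rw [cfc_mul f g T hf hg, mul_apply_eq_comp,
    ← ContinuousLinearMap.adjoint_inner_right (cfc f T), hsa.adjoint_eq]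

theorem re_inner_cfc_le {T : H →L[ℂ] H} {f g : ℝ → ℝ}
    (hf : ContinuousOn f (spectrum ℝ T)) (hg : ContinuousOn g (spectrum ℝ T))
    (h : ∀ r ∈ spectrum ℝ T, f r ≤ g r) (x : H) :
    (inner ℂ x (cfc f T x)).re ≤ (inner ℂ x (cfc g T x)).re := by
  have h1 : cfc f T ≤ cfc g T := cfc_mono h hf hg
  rw [ContinuousLinearMap.le_def] at h1
  have := h1.re_inner_nonneg_right x
  simpa [inner_sub_right] using this

theorem norm_cfc_apply_sq {T : H →L[ℂ] H} {f : ℝ → ℝ}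
    (hf : ContinuousOn f (spectrum ℝ T)) (x : H) :
    ‖cfc f T x‖ ^ 2 = (inner ℂ x (cfc (fun r => f r * f r) T x)).re := by
  rw [← inner_cfc_cfc hf hf, inner_self_eq_norm_sq_to_K]
  norm_cast

/-- Turns scalar inequalities on the spectrum into vector estimates; all comparisons of T with T^s
below come from it. -/
theorem norm_cfc_apply_sq_le {T : H →L[ℂ] H} (hT : IsSelfAdjoint T) {f g : ℝ → ℝ}
    (hf : ContinuousOn f (spectrum ℝ T)) (hg : ContinuousOn g (spectrum ℝ T)) {a b : ℝ}
    (h : ∀ r ∈ spectrum ℝ T, f r ^ 2 ≤ a * g r ^ 2 + b) (x : H) :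
    ‖cfc f T x‖ ^ 2 ≤ a * ‖cfc g T x‖ ^ 2 + b * ‖x‖ ^ 2 := by
  rw [norm_cfc_apply_sq hf, norm_cfc_apply_sq hg]
  have h1 := re_inner_cfc_le (T := T) (f := fun r => f r * f r)
    (g := fun r => a * (g r * g r) + b) (by fun_prop) (by fun_prop)
    (fun r hr => by simpa [sq] using h r hr) x
  refine h1.trans_eq ?_
  rw [cfc_add_const b (fun r => a * (g r * g r)) T (by fun_prop) hT,
    cfc_const_mul a (fun r => g r * g r) T (by fun_prop)]
  simp [Algebra.algebraMap_eq_smul_one, inner_smul_right_eq_smul, inner_self_eq_norm_sq_to_K]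
  norm_cast
  exact Or.inl rfl

theorem spectrum_subset_Icc {T : H →L[ℂ] H} (hT : 0 ≤ T) {r : ℝ} (hr : r ∈ spectrum ℝ T) :
    0 ≤ r ∧ r ≤ ‖T‖ := by
  refine ⟨spectrum_nonneg_of_nonneg hT hr, ?_⟩
  obtain h | h := subsingleton_or_nontrivial (H →L[ℂ] H)
  · exact absurd hr (by simp [spectrum.of_subsingleton])
  · exact (le_abs_self r).trans (spectrum.norm_le_norm_of_mem hr)

theorem continuousOn_rpow_const {s : ℝ} (hs : 0 ≤ s) (S : Set ℝ) :
    ContinuousOn (fun r : ℝ => r ^ s) S :=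
  (Real.continuous_rpow_const hs).continuousOn

/-- Jensen's inequality for the concave u ↦ u^s with u = r²: the graph lies below its tangent at u =
t², whose slope and intercept are `a` and `b`. The scalar inequality is weighted AM-GM. -/
theorem norm_rpow_apply_le {T : H →L[ℂ] H} (hT : 0 ≤ T) {s : ℝ} (hs0 : 0 < s) (hs1 : s ≤ 1)
    {t : ℝ} (ht : 0 < t) {x : H} (hx : ‖T x‖ ≤ t * ‖x‖) : ‖(T ^ s) x‖ ≤ t ^ s * ‖x‖ := by
  have hsa : IsSelfAdjoint T := .of_nonneg hT
  have key := norm_cfc_apply_sq_le hsa (f := fun r => r ^ s) (g := id)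
    (continuousOn_rpow_const hs0.le _) continuousOn_id
    (a := s * (t ^ 2) ^ (s - 1)) (b := (1 - s) * (t ^ 2) ^ s) (fun r hr => ?_) x
  · rw [CFC.rpow_eq_cfc_real hT]
    rw [cfc_id ℝ T hsa] at key
    have h1 : ‖T x‖ ^ 2 ≤ t ^ 2 * ‖x‖ ^ 2 := by
      rw [← mul_pow]
      gcongr
    have h2 : (t ^ 2) ^ (s - 1) * t ^ 2 = (t ^ s) ^ 2 := by
      rw [Real.rpow_sub_one (by positivity), div_mul_cancel₀ _ (by positivity),
        ← Real.rpow_natCast, ← Real.rpow_natCast, ← Real.rpow_mul ht.le, ← Real.rpow_mul ht.le,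
        mul_comm]
    have h3 : (t ^ 2) ^ s = (t ^ s) ^ 2 := by
      rw [← Real.rpow_natCast, ← Real.rpow_natCast, ← Real.rpow_mul ht.le, ← Real.rpow_mul ht.le,
        mul_comm]
    refine le_of_sq_le_sq ?_ (by positivity)
    calc _ ≤ _ := key
      _ ≤ s * (t ^ 2) ^ (s - 1) * (t ^ 2 * ‖x‖ ^ 2) + (1 - s) * (t ^ 2) ^ s * ‖x‖ ^ 2 := by gcongr
      _ = s * ((t ^ 2) ^ (s - 1) * t ^ 2) * ‖x‖ ^ 2 + (1 - s) * (t ^ 2) ^ s * ‖x‖ ^ 2 := by ring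
      _ = _ := by rw [h2, h3]; ring
  · have hr0 := (spectrum_subset_Icc hT hr).1
    have h := Real.geom_mean_le_arith_mean2_weighted hs0.le (by linarith : 0 ≤ 1 - s)
      (sq_nonneg r) (sq_nonneg t) (by ring)
    have h2 : (t ^ 2) ^ (1 - s) * (t ^ 2) ^ (s - 1) = 1 := by
      rw [← Real.rpow_add (by positivity)]
      simp
    have h3 : t ^ 2 * (t ^ 2) ^ (s - 1) = (t ^ 2) ^ s := by
      rw [Real.rpow_sub_one (by positivity), mul_div_cancel₀ _ (by positivity)]
    have h4 : (r ^ s) ^ 2 = (r ^ 2) ^ s := by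
      rw [← Real.rpow_natCast, ← Real.rpow_natCast, ← Real.rpow_mul hr0, ← Real.rpow_mul hr0,
        mul_comm]
    have h5 := mul_le_mul_of_nonneg_right h (by positivity : 0 ≤ (t ^ 2) ^ (s - 1))
    rw [mul_assoc, h2, mul_one, add_mul] at h5
    simp only [id]
    rw [h4]
    refine h5.trans_eq ?_
    rw [← h3]
    ring

theorem abs_rpow_sub_rpow_le {s μ r : ℝ} (hs0 : 0 < s) (hs1 : s ≤ 1) (hμ : 0 < μ) (hr : 0 ≤ r) :
    |r ^ s - μ ^ s| ≤ μ ^ (s - 1) * |r - μ| := by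
  have h1 : ∀ q : ℝ, 0 ≤ q → |q ^ s - 1| ≤ |q - 1| := fun q hq => by
    rcases le_total q 1 with h | h
    · have h2 := Real.rpow_le_one hq h hs0.le
      have h3 := Real.rpow_le_rpow_of_exponent_ge' hq h hs0.le hs1
      rw [Real.rpow_one] at h3
      rw [abs_of_nonpos (by linarith), abs_of_nonpos (by linarith)]
      linarith
    · have h2 := Real.one_le_rpow h hs0.le
      have h3 := Real.rpow_le_rpow_of_exponent_le h hs1
      rw [Real.rpow_one] at h3
      rw [abs_of_nonneg (by linarith), abs_of_nonneg (by linarith)]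
      linarith
  have h2 := h1 (r / μ) (by positivity)
  rw [Real.div_rpow hr hμ.le] at h2
  have h3 : r ^ s - μ ^ s = μ ^ s * (r ^ s / μ ^ s - 1) := by
    field_simp
  have h4 : r - μ = μ * (r / μ - 1) := by
    field_simp
  rw [h3, h4, abs_mul, abs_mul, abs_of_pos hμ, abs_of_pos (by positivity : 0 < μ ^ s), ← mul_assoc,
    Real.rpow_sub_one hμ.ne', div_mul_cancel₀ _ hμ.ne']
  gcongr

/-- Since |r^s - μ^s| is at most a constant times |r - μ| on the spectrum, T^s - μ^s vanishes
wherever T - μ does. -/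
theorem rpow_apply_of_apply_eq {T : H →L[ℂ] H} (hT : 0 ≤ T) {s : ℝ} (hs0 : 0 < s) (hs1 : s ≤ 1)
    {μ : ℝ} (hμ : 0 < μ) {x : H} (hx : T x = (μ : ℂ) • x) :
    (T ^ s) x = ((μ ^ s : ℝ) : ℂ) • x := by
  have hsa : IsSelfAdjoint T := .of_nonneg hT
  have key := norm_cfc_apply_sq_le hsa (f := fun r => r ^ s - μ ^ s) (g := fun r => r - μ)
    ((continuousOn_rpow_const hs0.le _).sub continuousOn_const) (by fun_prop)
    (a := (μ ^ (s - 1)) ^ 2) (b := 0) (fun r hr => ?_) x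
  · rw [cfc_sub (fun r => r ^ s) (fun _ => μ ^ s) T (continuousOn_rpow_const hs0.le _),
      cfc_sub (fun r => r) (fun _ => μ) T, cfc_const _ T hsa, cfc_const _ T hsa, cfc_id' ℝ T hsa,
      ← CFC.rpow_eq_cfc_real hT] at key
    have h0 : (T - algebraMap ℝ (H →L[ℂ] H) μ) x = 0 := by
      simp [Algebra.algebraMap_eq_smul_one, hx]
    rw [h0] at key
    have h1 : (T ^ s - algebraMap ℝ (H →L[ℂ] H) (μ ^ s)) x = 0 := by
      rw [← norm_eq_zero, ← sq_eq_zero_iff]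
      refine le_antisymm (by simpa using key) (sq_nonneg _)
    simpa [Algebra.algebraMap_eq_smul_one, sub_eq_zero] using h1
  · rw [add_zero, ← sq_abs, ← sq_abs (r - μ), ← mul_pow]
    have := abs_rpow_sub_rpow_le hs0 hs1 hμ (spectrum_subset_Icc hT hr).1
    gcongr

/-- On the spectrum r = r^(1-s) r^s ≤ ‖T‖^(1-s) r^s. This transfers compactness from |A|^s to A. -/
theorem norm_apply_le_rpow {T : H →L[ℂ] H} (hT : 0 ≤ T) {s : ℝ} (hs0 : 0 < s) (hs1 : s ≤ 1)
    (x : H) : ‖T x‖ ≤ ‖T‖ ^ (1 - s) * ‖(T ^ s) x‖ := by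
  have hsa : IsSelfAdjoint T := .of_nonneg hT
  have key := norm_cfc_apply_sq_le hsa (f := id) (g := fun r => r ^ s)
    continuousOn_id (continuousOn_rpow_const hs0.le _)
    (a := (‖T‖ ^ (1 - s)) ^ 2) (b := 0) (fun r hr => ?_) x
  · rw [cfc_id ℝ T hsa, ← CFC.rpow_eq_cfc_real hT, zero_mul, add_zero, ← mul_pow] at key
    exact le_of_sq_le_sq key (by positivity)
  · obtain ⟨hr0, hr1⟩ := spectrum_subset_Icc hT hr
    rw [add_zero, ← mul_pow, id]
    gcongr
    calc r = r ^ (1 - s) * r ^ s := by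
          rw [← Real.rpow_add_of_nonneg hr0 (by linarith) hs0.le]
          simp
      _ ≤ _ := by gcongr

end PositiveOperators

/-! ### The top of the spectrum: accumulation points and eigenvectors -/

section TopOfSpectrum

open Module Submodule

variable {H : Type*} [NormedAddCommGroup H] [InnerProductSpace ℂ H]

theorem mem_realEigenspace {T : H →L[ℂ] H} {η : ℝ} {x : H} :
    x ∈ realEigenspace T η ↔ T x = (η : ℂ) • x := by
  simp [realEigenspace]

variable [CompleteSpace H]

theorem specTop_eq_norm {T : H →L[ℂ] H} (hT : 0 ≤ T) : specTop T = ‖T‖ := by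
  obtain h | h := subsingleton_or_nontrivial (H →L[ℂ] H)
  · simp [specTop, spectrum.of_subsingleton, Subsingleton.elim T 0]
  · exact le_antisymm (csSup_le ⟨_, CStarAlgebra.norm_mem_spectrum_of_nonneg hT⟩
      fun r hr => (spectrum_subset_Icc hT hr).2)
      (le_csSup ⟨‖T‖, fun r hr => (spectrum_subset_Icc hT hr).2⟩
        (CStarAlgebra.norm_mem_spectrum_of_nonneg hT))

theorem exists_cfc_apply_ne_zero {T : H →L[ℂ] H} (hT : IsSelfAdjoint T) {f : ℝ → ℝ}
    (hf : ContinuousOn f (spectrum ℝ T)) {r : ℝ} (hr : r ∈ spectrum ℝ T) (hfr : f r ≠ 0) :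
    ∃ x, cfc f T x ≠ 0 := by
  by_contra! h
  have h0 : cfc f T = cfc (fun _ => (0 : ℝ)) T := by
    rw [cfc_const_zero]
    ext x
    simpa using h x
  exact hfr (eqOn_of_cfc_eq_cfc h0 hf continuousOn_const hT hr)

theorem exists_pos_forall_le_dist (S : Finset ℝ) :
    ∃ δ > 0, ∀ a ∈ S, ∀ b ∈ S, a ≠ b → δ ≤ |a - b| := by
  rcases (S : Set ℝ).subsingleton_or_nontrivial with h | h
  · exact ⟨1, one_pos, fun a ha b hb hab => (hab (h ha hb)).elim⟩
  · exact ⟨(S : Set ℝ).infsep, (S.finite_toSet.infsep_pos_iff_nontrivial).2 h,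
      fun a ha b hb hab => Set.infsep_le_dist_of_mem ha hb hab⟩

/-- If `F` does not vanish at infinitely many points of the spectrum, then `F(T)` has infinite
rank. -/
theorem not_finiteDimensional_range_cfc {T : H →L[ℂ] H} (hT : IsSelfAdjoint T) {F : ℝ → ℝ}
    (hF : Continuous F) (h : {r ∈ spectrum ℝ T | F r ≠ 0}.Infinite) :
    ¬ FiniteDimensional ℂ (LinearMap.range (cfc F T : H →L[ℂ] H).toLinearMap) := by
  intro hfd
  obtain ⟨S, hS, hcard⟩ := h.exists_subset_card_eq
    (finrank ℂ (LinearMap.range (cfc F T : H →L[ℂ] H).toLinearMap) + 1)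
  obtain ⟨δ, hδ, hdist⟩ := exists_pos_forall_le_dist S
  -- Tent functions of radius δ/2 around δ-separated points have pairwise vanishing products, so the
  -- vectors chosen below are orthogonal.
  let f : ℝ → ℝ → ℝ := fun a r => max 0 (δ / 2 - |r - a|)
  have hfc : ∀ a, Continuous (f a) := fun a => by fun_prop
  have hne : ∀ a : S, ∃ x, cfc (fun r => F r * f a r) T x ≠ 0 := fun a =>
    exists_cfc_apply_ne_zero hT (hF.mul (hfc a)).continuousOn (hS a.2).1
      (mul_ne_zero (hS a.2).2 (by simp [f, hδ]))
  choose x hx using hne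
  let v : S → LinearMap.range (cfc F T : H →L[ℂ] H).toLinearMap := fun a =>
    ⟨cfc (fun r => F r * f a r) T (x a), cfc (f a) T (x a), by
      rw [cfc_mul F (f a) T hF.continuousOn (hfc a).continuousOn]
      rfl⟩
  have hv : LinearIndependent ℂ v := by
    refine linearIndependent_of_ne_zero_of_inner_eq_zero
      (fun a ha => hx a (congrArg Subtype.val ha)) fun a b hab => ?_
    change inner ℂ (cfc (fun r => F r * f a r) T (x a)) (cfc (fun r => F r * f b r) T (x b)) = 0
    rw [inner_cfc_cfc (f := fun r => F r * f a r) (g := fun r => F r * f b r)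
      (hF.mul (hfc a)).continuousOn (hF.mul (hfc b)).continuousOn]
    have h0 : (fun r => F r * f a r * (F r * f b r)) = fun _ => 0 := by
      funext r
      have hd := hdist a a.2 b b.2 (fun h => hab (Subtype.ext h))
      have hab : f a r = 0 ∨ f b r = 0 := by
        by_contra! hne
        have h1 : |r - a| < δ / 2 := by
          by_contra! hle
          exact hne.1 (max_eq_left (by linarith))
        have h2 : |r - b| < δ / 2 := by
          by_contra! hle
          exact hne.2 (max_eq_left (by linarith))
        have h3 := abs_sub_le (a : ℝ) r b
        rw [abs_sub_comm (a : ℝ) r] at h3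
        linarith
      rcases hab with h | h <;> simp [h]
    rw [h0, cfc_const_zero]
    simp
  have := hv.fintype_card_le_finrank
  rw [Fintype.card_coe, hcard] at this
  omega

theorem infinite_of_accPt {S : Set ℝ} {η : ℝ} (h : AccPt η (Filter.principal S)) {U : Set ℝ}
    (hU : U ∈ 𝓝 η) : {r ∈ S | r ∈ U}.Infinite := by
  intro hfin
  have h1 := h.nhds_inter hU
  rw [accPt_iff_frequently] at h1
  have h2 : ({r ∈ S | r ∈ U} \ {η})ᶜ ∈ 𝓝 η :=
    (hfin.subset Set.sdiff_subset).isClosed.isOpen_compl.mem_nhds (by simp)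
  obtain ⟨y, ⟨hne, hyU, hyS⟩, hy⟩ := (h1.and_eventually h2).exists
  exact hy ⟨⟨hyS, hyU⟩, hne⟩

/-- A tent F of radius ε at η meets infinitely many spectral points, so F(T) has infinite rank,
while ‖T x‖ ≥ (η - ε)‖x‖ on its range. -/
theorem le_gelfandNumber_of_accPt {T : H →L[ℂ] H} (hT : 0 ≤ T) {η : ℝ}
    (h : AccPt η (Filter.principal (spectrum ℝ T))) (j : ℕ) : η ≤ gelfandNumber T j := by
  have hsa : IsSelfAdjoint T := .of_nonneg hT
  refine le_of_forall_pos_le_add fun ε hε => ?_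
  rw [← sub_le_iff_le_add]
  rcases le_or_gt (η - ε) 0 with h0 | h0
  · exact h0.trans (gelfandNumber_nonneg T j)
  let F : ℝ → ℝ := fun r => max 0 (ε - |r - η|)
  have hF : Continuous F := by fun_prop
  have hF0 : ∀ r, F r ≠ 0 → |r - η| < ε := fun r hr => by
    by_contra! hle
    exact hr (max_eq_left (by linarith))
  refine le_gelfandNumber_of_subspace (LinearMap.range (cfc F T : H →L[ℂ] H).toLinearMap)
    (fun hfd => (not_finiteDimensional_range_cfc hsa hF ?_ hfd).elim) ?_
  · refine (infinite_of_accPt h (Metric.ball_mem_nhds η hε)).mono fun r hr => ⟨hr.1, ?_⟩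
    have : |r - η| < ε := hr.2
    exact (lt_max_of_lt_right (by linarith)).ne'
  · rintro _ ⟨y, rfl⟩
    have key := norm_cfc_apply_sq_le hsa (f := F) (g := fun r => r * F r) hF.continuousOn
      (by fun_prop) (a := ((η - ε) ^ 2)⁻¹) (b := 0) (fun r hr => ?_) y
    · rw [cfc_mul (fun r => r) F T continuousOn_id hF.continuousOn, cfc_id' ℝ T hsa,
        zero_mul, add_zero, inv_mul_eq_div, le_div_iff₀ (by positivity), mul_comm, ← mul_pow] at key
      exact le_of_sq_le_sq key (norm_nonneg _)
    · rw [add_zero, inv_mul_eq_div, le_div_iff₀ (by positivity), mul_comm, ← mul_pow]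
      by_cases hr0 : F r = 0
      · simp [hr0]
      · have h1 := (abs_lt.1 (hF0 r hr0)).1
        have h2 : 0 ≤ F r := le_max_left _ _
        gcongr
        linarith

/-- A tent F around an isolated spectral point η satisfies r F(r) = η F(r) on the spectrum, so the
nonzero range of F(T) consists of eigenvectors. -/
theorem exists_eigenvector_of_not_accPt {T : H →L[ℂ] H} (hT : IsSelfAdjoint T) {η : ℝ}
    (hη : η ∈ spectrum ℝ T) (h : ¬ AccPt η (Filter.principal (spectrum ℝ T))) :
    ∃ x ∈ realEigenspace T η, x ≠ 0 := by
  rw [accPt_iff_frequently, Filter.not_frequently, Metric.eventually_nhds_iff] at h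
  obtain ⟨δ, hδ, hiso⟩ := h
  let F : ℝ → ℝ := fun r => max 0 (δ - |r - η|)
  have hF : Continuous F := by fun_prop
  obtain ⟨y, hy⟩ := exists_cfc_apply_ne_zero hT hF.continuousOn hη (by simp [F, hδ])
  refine ⟨cfc F T y, ?_, hy⟩
  have h0 : cfc (fun r => r * F r) T = cfc (fun r => η * F r) T := by
    refine cfc_congr fun r hr => ?_
    by_cases hrη : r = η
    · simp [hrη]
    · have h1 : δ ≤ |r - η| := by
        by_contra! hlt
        exact hiso hlt ⟨hrη, hr⟩
      simp [F, max_eq_left (show δ - |r - η| ≤ 0 by linarith)]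
  rw [cfc_mul (fun r => r) F T continuousOn_id hF.continuousOn, cfc_id' ℝ T hT,
    cfc_const_mul η F T hF.continuousOn] at h0
  rw [mem_realEigenspace]
  simpa using congrArg (fun A : H →L[ℂ] H => A y) h0

end TopOfSpectrum

/-! ### Deflation and the min-max principle -/

section Deflation

open Module Submodule

variable {H : Type*} [NormedAddCommGroup H] [InnerProductSpace ℂ H] [CompleteSpace H]

section

variable {T : H →L[ℂ] H} {η : ℝ} {W : Submodule ℂ H} [W.HasOrthogonalProjection]

omit [CompleteSpace H] in
theorem sub_smul_starProjection_apply (hW : W ≤ realEigenspace T η) (x : H) :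
    (T - (η : ℂ) • W.starProjection) x = T (x - W.starProjection x) := by
  simp [mem_realEigenspace.1 (hW (W.starProjection_apply_mem x))]

omit [W.HasOrthogonalProjection] in
theorem apply_mem_orthogonal (hT : 0 ≤ T) (hW : W ≤ realEigenspace T η) {x : H} (hx : x ∈ Wᗮ) :
    T x ∈ Wᗮ := by
  rw [mem_orthogonal] at *
  intro w hw
  have hsa : IsSelfAdjoint T := .of_nonneg hT
  rw [← ContinuousLinearMap.adjoint_inner_left, hsa.adjoint_eq, mem_realEigenspace.1 (hW hw),
    inner_smul_left, hx w hw, mul_zero]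

theorem sub_smul_starProjection_nonneg (hT : 0 ≤ T) (hW : W ≤ realEigenspace T η) :
    0 ≤ T - (η : ℂ) • W.starProjection := by
  have h := ((ContinuousLinearMap.nonneg_iff_isPositive T).1 hT).conj_starProjection Wᗮ
  rw [ContinuousLinearMap.nonneg_iff_isPositive]
  convert h using 1
  ext x
  rw [sub_smul_starProjection_apply hW]
  simp only [ContinuousLinearMap.comp_apply]
  rw [starProjection_orthogonal_val x, starProjection_eq_self_iff.2
      (apply_mem_orthogonal hT hW (sub_starProjection_mem_orthogonal x))]

omit [CompleteSpace H] in
theorem norm_sub_smul_starProjection_le (hW : W ≤ realEigenspace T η) :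
    ‖T - (η : ℂ) • W.starProjection‖ ≤ ‖T‖ := by
  refine ContinuousLinearMap.opNorm_le_bound _ (norm_nonneg _) fun x => ?_
  rw [sub_smul_starProjection_apply hW]
  refine T.le_opNorm_of_le ?_
  rw [← starProjection_orthogonal_val]
  exact norm_starProjection_apply_le _ _

/-- Removing from `T` a part `W` of the top eigenspace shifts the Gelfand numbers by `dim W`. -/
theorem gelfandNumber_sub_smul_starProjection [FiniteDimensional ℂ W] (hT : 0 ≤ T)
    (hW : W ≤ realEigenspace T η) (hη : ‖T‖ ≤ η) (j : ℕ) :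
    gelfandNumber (T - (η : ℂ) • W.starProjection) j = gelfandNumber T (j + finrank ℂ W) := by
  refine le_antisymm (le_gelfandNumber ?_)
    (gelfandNumber_add_le_of_eqOn W le_rfl fun x hx => by
      simp [(starProjection_apply_eq_zero_iff W).2 hx])
  rintro t ⟨ht0, V, hV, hVj, hb⟩
  rcases le_or_gt η t with hηt | htη
  · exact (gelfandNumber_le_norm _ _).trans
      ((norm_sub_smul_starProjection_le hW).trans (hη.trans hηt))
  have hη0 : 0 < η := ht0.trans_lt htη
  -- Since t < η, W meets the complement of V only in 0, so W projects injectively onto a subspace U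
  -- of V. The part of V orthogonal to U has lost dim W dimensions and is the witness for the
  -- deflated operator.
  let f : W →ₗ[ℂ] H := (V.starProjection : H →ₗ[ℂ] H) ∘ₗ W.subtype
  let U : Submodule ℂ H := LinearMap.range f
  have hUV : U ≤ V := by
    rintro _ ⟨w, rfl⟩
    exact V.starProjection_apply_mem w
  have hU : finrank ℂ U = finrank ℂ W := by
    refine LinearMap.finrank_range_of_inj ?_
    rw [← LinearMap.ker_eq_bot, Submodule.eq_bot_iff]
    intro w hw
    have hwV : (w : H) ∈ Vᗮ := (starProjection_apply_eq_zero_iff V).1 hw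
    have h1 := hb w hwV
    rw [mem_realEigenspace.1 (hW w.2), norm_smul, Complex.norm_real, Real.norm_eq_abs,
      abs_of_pos hη0] at h1
    have h2 : ‖(w : H)‖ ≤ 0 := by
      by_contra! hpos
      exact (mul_lt_mul_of_pos_right htη hpos).not_ge h1
    exact Subtype.ext (norm_le_zero_iff.1 h2)
  refine gelfandNumber_le ⟨ht0, Uᗮ ⊓ V, inferInstance, ?_, fun x hx => ?_⟩
  · have := finrank_add_inf_finrank_orthogonal hUV
    omega
  have hPx : V.starProjection x ∈ U := by
    have h1 : V.starProjection x - U.starProjection (V.starProjection x) ∈ Uᗮ ⊓ V :=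
      ⟨sub_starProjection_mem_orthogonal _,
        V.sub_mem (V.starProjection_apply_mem _) (hUV (U.starProjection_apply_mem _))⟩
    have h2 : inner ℂ (V.starProjection x - U.starProjection (V.starProjection x))
        (V.starProjection x) = 0 := by
      have h3 := (mem_orthogonal _ _).1 hx _ h1
      have h4 := (mem_orthogonal _ _).1 (sub_starProjection_mem_orthogonal (K := V) x) _ h1.2
      rw [inner_sub_right, h3, zero_sub, neg_eq_zero] at h4
      exact h4
    have h3 : inner ℂ (V.starProjection x - U.starProjection (V.starProjection x))
        (U.starProjection (V.starProjection x)) = 0 :=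
      starProjection_inner_eq_zero _ _ (U.starProjection_apply_mem _)
    have h4 : V.starProjection x - U.starProjection (V.starProjection x) = 0 := by
      rw [← inner_self_eq_zero (𝕜 := ℂ), inner_sub_right, h2, h3, sub_zero]
    rw [sub_eq_zero.1 h4]
    exact U.starProjection_apply_mem _
  obtain ⟨⟨w, hw⟩, hwx⟩ := hPx
  change V.starProjection w = _ at hwx
  -- Subtracting w from x does not change the deflated operator's value, and moves the vector to
  -- where the bound for T is available.
  have hv : x - w ∈ Vᗮ := by
    rw [← starProjection_apply_eq_zero_iff, map_sub, sub_eq_zero]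
    exact hwx.symm
  set v := x - w with hv_def
  have hx : x = v + w := by simp [hv_def]
  have hxP : x - W.starProjection x = v - W.starProjection v := by
    rw [hx, map_add, starProjection_eq_self_iff.2 hw]
    abel
  rw [sub_smul_starProjection_apply hW, hxP]
  have hbv := hb v hv
  set y := v - W.starProjection v with hy_def
  have hyW : y ∈ Wᗮ := sub_starProjection_mem_orthogonal v
  have hTy : T y ∈ Wᗮ := apply_mem_orthogonal hT hW hyW
  have hvy : v = W.starProjection v + y := by simp [hy_def]
  have h1 : ‖v‖ ^ 2 = ‖W.starProjection v‖ ^ 2 + ‖y‖ ^ 2 := by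
    conv_lhs => rw [hvy]
    simpa [sq] using norm_add_sq_eq_norm_sq_add_norm_sq_of_inner_eq_zero (𝕜 := ℂ) _ _
      ((mem_orthogonal _ _).1 hyW _ (W.starProjection_apply_mem v))
  have h2 : ‖T v‖ ^ 2 = η ^ 2 * ‖W.starProjection v‖ ^ 2 + ‖T y‖ ^ 2 := by
    conv_lhs => rw [hvy, map_add, mem_realEigenspace.1 (hW (W.starProjection_apply_mem v))]
    have := norm_add_sq_eq_norm_sq_add_norm_sq_of_inner_eq_zero (𝕜 := ℂ)
      ((η : ℂ) • W.starProjection v) (T y)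
      ((mem_orthogonal _ _).1 hTy _ (W.smul_mem _ (W.starProjection_apply_mem v)))
    simpa [← sq, norm_smul, mul_pow] using this
  have h3 : ‖T v‖ ^ 2 ≤ t ^ 2 * ‖v‖ ^ 2 := by
    rw [← mul_pow]
    gcongr
  -- In the Pythagorean splitting of v, the W-component is stretched by η ≥ t, so the bound t for v
  -- passes to its remainder y.
  have h4 : ‖T y‖ ^ 2 ≤ t ^ 2 * ‖y‖ ^ 2 := by
    have : t ^ 2 * ‖W.starProjection v‖ ^ 2 ≤ η ^ 2 * ‖W.starProjection v‖ ^ 2 := by gcongr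
    rw [h2, h1] at h3
    linarith
  have h5 : ‖T y‖ ≤ t * ‖y‖ := by
    rw [← mul_pow] at h4
    exact le_of_sq_le_sq h4 (by positivity)
  refine h5.trans (mul_le_mul_of_nonneg_left ?_ ht0)
  rw [← hxP, ← starProjection_orthogonal_val]
  exact norm_starProjection_apply_le _ _

end

/-- Both sides obey one recursion: the value is ‖T‖ while the top is in the condensed spectrum or j
is below its multiplicity; otherwise deflation shifts the index by that multiplicity. -/
theorem lambdaNumber_eq_gelfandNumber {T : H →L[ℂ] H} (hT : 0 ≤ T) (j : ℕ) :
    lambdaNumber T j = gelfandNumber T j := by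
  induction j using Nat.strong_induction_on generalizing T with
  | _ j ih =>
  have hη := specTop_eq_norm hT
  have hup : gelfandNumber T j ≤ specTop T := (gelfandNumber_le_norm T j).trans_eq hη.symm
  have heig : (FiniteDimensional ℂ (realEigenspace T (specTop T)) → j < topMult T) →
      specTop T ≤ gelfandNumber T j := fun h => by
    refine le_gelfandNumber_of_subspace _ h fun x hx => ?_
    rw [mem_realEigenspace.1 hx, norm_smul, Complex.norm_real, Real.norm_eq_abs,
      abs_of_nonneg (hη ▸ norm_nonneg T)]
  rw [lambdaNumber]
  split_ifs with h
  · refine le_antisymm ?_ hup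
    by_cases hc : specTop T ∈ condensedSpectrum T
    · rcases hc.2 with hacc | hinf
      · exact le_gelfandNumber_of_accPt hT hacc j
      · exact heig fun hfd => (hinf hfd).elim
    -- Multiplicity zero outside the condensed spectrum forces the zero space, since an isolated top
    -- has an eigenvector.
    rcases (or_iff_right hc).1 h with h0 | hj
    · obtain hs | hs := subsingleton_or_nontrivial (H →L[ℂ] H)
      · rw [hη, Subsingleton.elim T 0, norm_zero]
        exact gelfandNumber_nonneg _ _
      have hmem : specTop T ∈ spectrum ℝ T := hη ▸ CStarAlgebra.norm_mem_spectrum_of_nonneg hT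
      have hnc : ¬ AccPt (specTop T) (Filter.principal (spectrum ℝ T)) :=
        fun hacc => hc ⟨hmem, Or.inl hacc⟩
      have hfd : FiniteDimensional ℂ (realEigenspace T (specTop T)) := by
        by_contra hfd
        exact hc ⟨hmem, Or.inr hfd⟩
      obtain ⟨x, hx, hx0⟩ := exists_eigenvector_of_not_accPt (.of_nonneg hT) hmem hnc
      rw [Submodule.finrank_eq_zero.1 h0, mem_bot] at hx
      exact (hx0 hx).elim
    · exact heig fun _ => hj
  · push Not at h
    obtain ⟨hc, h0, hj⟩ := h
    have hfd : FiniteDimensional ℂ (realEigenspace T (specTop T)) :=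
      FiniteDimensional.of_finrank_pos (Nat.pos_of_ne_zero h0)
    have hd : 0 ≤ deflate T := sub_smul_starProjection_nonneg hT le_rfl
    rw [ih (j - topMult T) (by omega) hd, deflate,
      gelfandNumber_sub_smul_starProjection hT le_rfl hη.ge]
    congr 1
    exact Nat.sub_add_cancel hj

theorem inner_cfcAbs_apply (A : H →L[ℂ] H) (x y : H) :
    inner ℂ (CFC.abs A x) (CFC.abs A y) = inner ℂ (A x) (A y) := by
  have h := CFC.abs_mul_abs A
  have hsa : IsSelfAdjoint (CFC.abs A) := .of_nonneg (CFC.abs_nonneg A)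
  rw [← ContinuousLinearMap.adjoint_inner_right, hsa.adjoint_eq,
    ← ContinuousLinearMap.adjoint_inner_right A, ← mul_apply_eq_comp, h]
  rfl

theorem norm_cfcAbs_apply (A : H →L[ℂ] H) (x : H) : ‖CFC.abs A x‖ = ‖A x‖ := by
  have h1 := inner_cfcAbs_apply A x x
  rw [inner_self_eq_norm_sq_to_K, inner_self_eq_norm_sq_to_K] at h1
  exact (sq_eq_sq₀ (norm_nonneg _) (norm_nonneg _)).1 (by exact_mod_cast h1)

theorem gelfandNumber_cfcAbs (A : H →L[ℂ] H) : gelfandNumber (CFC.abs A) = gelfandNumber A :=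
  gelfandNumber_congr (norm_cfcAbs_apply A)

theorem sNumber_of_nonneg {T : H →L[ℂ] H} (hT : 0 ≤ T) : sNumber T = gelfandNumber T := by
  funext j
  rw [sNumber, CFC.abs_of_nonneg T hT, lambdaNumber_eq_gelfandNumber hT]

end Deflation

/-! ### Adapted orthonormal vectors and leading eigenvectors -/

section SchmidtVectors

open Module Submodule

variable {H : Type*} [NormedAddCommGroup H] [InnerProductSpace ℂ H]

theorem orthonormal_finCons {E : Type*} [NormedAddCommGroup E] [InnerProductSpace ℂ E] {n : ℕ}
    {x : E} {v : Fin n → E} (hx : ‖x‖ = 1) (hxv : ∀ i, inner ℂ x (v i) = 0)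
    (hv : Orthonormal ℂ v) : Orthonormal ℂ (Fin.cons x v : Fin (n + 1) → E) := by
  refine ⟨fun i => ?_, fun i j hij => ?_⟩
  · refine Fin.cases ?_ (fun i => ?_) i
    · simpa using hx
    · simpa using hv.1 i
  · induction i using Fin.cases with
    | zero =>
      induction j using Fin.cases with
      | zero => exact (hij rfl).elim
      | succ j => simpa using hxv j
    | succ i =>
      induction j using Fin.cases with
      | zero => simpa using inner_eq_zero_symm.1 (hxv i)
      | succ j => simpa using hv.2 (fun h => hij (congrArg Fin.succ h))

/-- In the range of an isometry of `ℂⁿ` there are orthonormal vectors on which `X` is bounded by its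
Gelfand numbers. -/
theorem exists_orthonormal_norm_le {n : ℕ} (X : H →L[ℂ] H)
    (E : EuclideanSpace ℂ (Fin n) →ₗᵢ[ℂ] H) {ε : ℝ} (hε : 0 < ε) {m : ℕ} (hm : m ≤ n) :
    ∃ v : Fin m → EuclideanSpace ℂ (Fin n), Orthonormal ℂ v ∧
      ∀ i, ‖X (E (v i))‖ ≤ gelfandNumber X (n - m + i) + ε := by
  induction m with
  | zero => exact ⟨Fin.elim0, ⟨fun i => i.elim0, fun i => i.elim0⟩, fun i => i.elim0⟩
  | succ m ih =>
    obtain ⟨v, hv, hvX⟩ := ih (by omega)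
    obtain ⟨-, V, hV, hVn, hb⟩ := isGelfandBound_of_lt
      (show gelfandNumber X (n - (m + 1)) < gelfandNumber X (n - (m + 1)) + ε by linarith)
    let S : Submodule ℂ H := span ℂ (Set.range fun i => E (v i))
    have hS : finrank ℂ S ≤ m := (finrank_range_le_card _).trans_eq (Fintype.card_fin m)
    have hfdS : FiniteDimensional ℂ S := FiniteDimensional.span_of_finite ℂ (Set.finite_range _)
    have hrange : finrank ℂ (LinearMap.range E.toLinearMap) = n := by
      rw [LinearMap.finrank_range_of_inj E.injective]
      simp
    -- V has dimension at most n - m - 1 and S at most m, so together they leave a direction in the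
    -- n-dimensional range of E. Vectors are added at the front, in decreasing order of Gelfand
    -- index.
    obtain ⟨_, ⟨u, rfl⟩, hu, hu0⟩ := exists_ne_zero_mem_orthogonal
      (LinearMap.range E.toLinearMap) (V ⊔ S) fun _ => by
        have := finrank_add_le_finrank_add_finrank V S
        omega
    change E u ∈ _ at hu
    replace hu0 : u ≠ 0 := fun h => hu0 (by simp [h])
    have hbu := hb _ (orthogonal_le le_sup_left hu)
    rw [E.norm_map] at hbu
    refine ⟨Fin.cons (((‖u‖⁻¹ : ℝ) : ℂ) • u) v, orthonormal_finCons ?_ (fun i => ?_) hv,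
      fun i => ?_⟩
    · simp [norm_smul, hu0]
    · have h1 : inner ℂ (E (v i)) (E u) = 0 :=
        (mem_orthogonal _ _).1 (orthogonal_le le_sup_right hu) _ (subset_span (Set.mem_range_self i))
      rw [E.inner_map_map] at h1
      rw [inner_smul_left, inner_eq_zero_symm.1 h1, mul_zero]
    · induction i using Fin.cases with
      | zero =>
        simp only [Fin.cons_zero, map_smul, norm_smul, Complex.norm_real, norm_inv, norm_norm,
          Fin.val_zero, add_zero]
        rw [inv_mul_le_iff₀ (norm_pos_iff.2 hu0), mul_comm]
        exact hbu
      | succ i =>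
        have : n - (m + 1) + (i.succ : ℕ) = n - m + i := by
          rw [Fin.val_succ]
          omega
        rw [this]
        simpa using hvX i

variable [CompleteSpace H]

/-- The sum is the trace of a compression of X to ℂⁿ, so it can be computed in the basis adapted to
X by `exists_orthonormal_norm_le`. Compactness of X plays no role. -/
theorem re_sum_inner_le_sum_gelfandNumber {n : ℕ} (X : H →L[ℂ] H) {e f : Fin n → H}
    (he : Orthonormal ℂ e) (hf : Orthonormal ℂ f) :
    (∑ i, inner ℂ (f i) (X (e i))).re ≤ ∑ i : Fin n, gelfandNumber X i := by
  let b := EuclideanSpace.basisFun (Fin n) ℂ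
  have hlin : ∀ g : Fin n → H, b.toBasis.constr ℂ g ∘ b.toBasis = g := fun g => by
    funext i
    simp
  have hb : Orthonormal ℂ b.toBasis := by simp [b.orthonormal]
  let E := (b.toBasis.constr ℂ e).isometryOfOrthonormal hb ((hlin e).symm ▸ he)
  let F := (b.toBasis.constr ℂ f).isometryOfOrthonormal hb ((hlin f).symm ▸ hf)
  have hE : ∀ i, E (b i) = e i := fun i => by
    simp [E]
  have hF : ∀ i, F (b i) = f i := fun i => by
    simp [F]
  let M : EuclideanSpace ℂ (Fin n) →L[ℂ] EuclideanSpace ℂ (Fin n) :=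
    F.toContinuousLinearMap.adjoint ∘L X ∘L E.toContinuousLinearMap
  have hM : ∀ u v, inner ℂ u (M v) = inner ℂ (F u) (X (E v)) := fun u v => by
    simp [M, ContinuousLinearMap.adjoint_inner_right]
  refine le_of_forall_pos_le_add fun ε hε => ?_
  obtain ⟨v, hv, hvX⟩ := exists_orthonormal_norm_le X E
    (show 0 < ε / (n + 1) by positivity) le_rfl
  have hspan : ⊤ ≤ span ℂ (Set.range v) := by
    have := hv.linearIndependent.span_eq_top_of_card_eq_finrank' (by simp)
    exact this.ge
  let b' : OrthonormalBasis (Fin n) ℂ (EuclideanSpace ℂ (Fin n)) := OrthonormalBasis.mk hv hspan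
  have htr : ∑ i, inner ℂ (f i) (X (e i)) = ∑ i, inner ℂ (F (v i)) (X (E (v i))) := by
    have h1 := LinearMap.trace_eq_sum_inner (M : _ →ₗ[ℂ] _) b
    have h2 := LinearMap.trace_eq_sum_inner (M : _ →ₗ[ℂ] _) b'
    rw [h1] at h2
    simpa [hM, hE, hF, b'] using h2
  rw [htr, Complex.re_sum]
  have hterm : ∀ i, (inner ℂ (F (v i)) (X (E (v i)))).re ≤ gelfandNumber X i + ε / (n + 1) :=
    fun i => by
      have h1 := re_inner_le_norm (𝕜 := ℂ) (F (v i)) (X (E (v i)))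
      rw [F.norm_map, hv.1 i, one_mul] at h1
      exact h1.trans (by simpa using hvX i)
  refine (Finset.sum_le_sum fun i _ => hterm i).trans ?_
  rw [Finset.sum_add_distrib]
  have : (n : ℝ) * (ε / (n + 1)) ≤ ε := by
    rw [mul_div_assoc', div_le_iff₀ (by positivity)]
    nlinarith
  simpa using this

theorem GelfandCompact.exists_eigenvector {T : H →L[ℂ] H} (hT : 0 ≤ T) (hc : GelfandCompact T)
    (h0 : T ≠ 0) : ∃ x, ‖x‖ = 1 ∧ x ∈ realEigenspace T ‖T‖ := by
  have hn : Nontrivial (H →L[ℂ] H) := ⟨T, 0, h0⟩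
  obtain ⟨x, hx, hx0⟩ := exists_eigenvector_of_not_accPt (.of_nonneg hT)
    (CStarAlgebra.norm_mem_spectrum_of_nonneg hT) fun hacc => by
      obtain ⟨j, hj⟩ := gelfandCompact_iff.1 hc ‖T‖ (norm_pos_iff.2 h0)
      exact hj.not_ge (le_gelfandNumber_of_accPt hT hacc j)
  exact ⟨((‖x‖⁻¹ : ℝ) : ℂ) • x, by simp [norm_smul, hx0], Submodule.smul_mem _ _ hx⟩

theorem gelfandNumber_deflate_singleton {T : H →L[ℂ] H} (hT : 0 ≤ T) {x : H} (hx : ‖x‖ = 1)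
    (hxT : x ∈ realEigenspace T ‖T‖) (j : ℕ) :
    gelfandNumber (T - ((‖T‖ : ℝ) : ℂ) • (ℂ ∙ x).starProjection) j = gelfandNumber T (j + 1) := by
  rw [gelfandNumber_sub_smul_starProjection hT ((span_singleton_le_iff_mem _ _).2 hxT) le_rfl,
    finrank_span_singleton (norm_ne_zero_iff.1 (by simp [hx]))]

/-- Eigenvectors for the norm are peeled off one at a time, each deflation shifting the Gelfand
numbers by one. -/
theorem GelfandCompact.exists_orthonormal_eigenvectors {T : H →L[ℂ] H} (hT : 0 ≤ T)
    (hc : GelfandCompact T) {n : ℕ} (hpos : ∀ i < n, 0 < gelfandNumber T i) :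
    ∃ e : Fin n → H, Orthonormal ℂ e ∧ ∀ i, T (e i) = (gelfandNumber T i : ℂ) • e i := by
  induction n generalizing T with
  | zero => exact ⟨Fin.elim0, ⟨fun i => i.elim0, fun i => i.elim0⟩, fun i => i.elim0⟩
  | succ n ih =>
    have h0 : 0 < ‖T‖ := gelfandNumber_zero T ▸ hpos 0 n.succ_pos
    obtain ⟨x, hx, hxT⟩ := hc.exists_eigenvector hT (norm_pos_iff.1 h0)
    have hW : (ℂ ∙ x) ≤ realEigenspace T ‖T‖ := (span_singleton_le_iff_mem _ _).2 hxT
    have hshift := gelfandNumber_deflate_singleton hT hx hxT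
    set T' := T - ((‖T‖ : ℝ) : ℂ) • (ℂ ∙ x).starProjection with hT'
    have hc' : GelfandCompact T' := hc.of_le (a := 1) fun j => by
      rw [hshift, one_mul]
      exact gelfandNumber_antitone T j.le_succ
    obtain ⟨e, he, heT⟩ := ih (sub_smul_starProjection_nonneg hT hW) hc' fun i hi => by
      rw [hshift]
      exact hpos _ (by omega)
    -- An eigenvector of the deflated operator with nonzero eigenvalue lies in its range, which is
    -- orthogonal to x.
    have hmem : ∀ i, e i ∈ (ℂ ∙ x)ᗮ := fun i => by
      have h1 : T' (e i) ∈ (ℂ ∙ x)ᗮ := by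
        rw [hT', sub_smul_starProjection_apply hW]
        exact apply_mem_orthogonal hT hW (sub_starProjection_mem_orthogonal _)
      have h2 : (gelfandNumber T' i : ℂ) ≠ 0 := by
        rw [hshift]
        exact_mod_cast (hpos _ (by omega)).ne'
      rw [heT] at h1
      exact (Submodule.smul_mem_iff _ h2).1 h1
    refine ⟨Fin.cons x e, orthonormal_finCons hx (fun i => ?_) he, fun i => ?_⟩
    · exact (mem_orthogonal_singleton_iff_inner_right).1 (hmem i)
    · induction i using Fin.cases with
      | zero => simpa [gelfandNumber_zero] using mem_realEigenspace.1 hxT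
      | succ i =>
        have h1 := heT i
        rw [hshift, sub_smul_starProjection_apply hW,
          (starProjection_apply_eq_zero_iff _).2 (hmem i), sub_zero] at h1
        simpa using h1

/-- V is spanned by up to p successively peeled eigenvectors; if T is exhausted earlier, fewer
suffice. -/
theorem GelfandCompact.exists_submodule_gelfandNumber_le {T : H →L[ℂ] H} (hT : 0 ≤ T)
    (hc : GelfandCompact T) (p : ℕ) : ∃ V : Submodule ℂ H, ∃ _ : FiniteDimensional ℂ V,
      finrank ℂ V ≤ p ∧ ∀ i, gelfandNumber (T * Vᗮ.starProjection) i ≤ gelfandNumber T (i + p) := by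
  induction p generalizing T with
  | zero => exact ⟨⊥, inferInstance, by simp, fun i => gelfandNumber_mul_le _ _
      (starProjection_norm_le _) _⟩
  | succ p ih =>
    by_cases h0 : T = 0
    · refine ⟨⊥, inferInstance, by simp, fun i => ?_⟩
      rw [h0, zero_mul]
      exact (gelfandNumber_le_norm _ _).trans (by simpa using gelfandNumber_nonneg _ _)
    obtain ⟨x, hx, hxT⟩ := hc.exists_eigenvector hT h0
    have hW : (ℂ ∙ x) ≤ realEigenspace T ‖T‖ := (span_singleton_le_iff_mem _ _).2 hxT
    have hshift := gelfandNumber_deflate_singleton hT hx hxT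
    set T' := T - ((‖T‖ : ℝ) : ℂ) • (ℂ ∙ x).starProjection with hT'
    have hc' : GelfandCompact T' := hc.of_le (a := 1) fun j => by
      rw [hshift, one_mul]
      exact gelfandNumber_antitone T j.le_succ
    obtain ⟨V, hV, hVp, hVT⟩ := ih (sub_smul_starProjection_nonneg hT hW) hc'
    refine ⟨V ⊔ (ℂ ∙ x), inferInstance, ?_, fun i => ?_⟩
    · exact (finrank_add_le_finrank_add_finrank _ _).trans
        (add_le_add hVp (finrank_span_singleton (norm_ne_zero_iff.1 (by simp [hx]))).le)
    · have h1 := hVT i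
      rw [hshift, add_assoc] at h1
      refine le_trans (le_of_eq_of_le ?_ (gelfandNumber_mul_le (T' * Vᗮ.starProjection)
        (V ⊔ (ℂ ∙ x))ᗮ.starProjection (starProjection_norm_le _) i)) h1
      congr 1
      ext y
      have hy := (V ⊔ (ℂ ∙ x))ᗮ.starProjection_apply_mem y
      set z := (V ⊔ (ℂ ∙ x))ᗮ.starProjection y
      change T z = T' (Vᗮ.starProjection z)
      rw [starProjection_eq_self_iff.2 (orthogonal_le le_sup_left hy), hT',
        sub_smul_starProjection_apply hW,
        (starProjection_apply_eq_zero_iff _).2 (orthogonal_le le_sup_right hy), sub_zero]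

end SchmidtVectors

/-! ### From truncated sums to sums of powers -/

section PowerSums

/-- Expresses x^s through the truncations min(x,t). The integral splits at t = x; stopping at the
finite M costs the linear term. -/
theorem intervalIntegral_min_mul_rpow {s M x : ℝ} (hs0 : 0 < s) (hs1 : s < 1) (hx : 0 ≤ x)
    (hxM : x ≤ M) (hM : 0 < M) :
    IntervalIntegrable (fun t => min x t * t ^ (s - 2)) MeasureTheory.volume 0 M ∧
      ∫ t in (0 : ℝ)..M, min x t * t ^ (s - 2) =
        (1 / s + 1 / (1 - s)) * x ^ s - M ^ (s - 1) / (1 - s) * x := by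
  rcases hx.eq_or_lt with rfl | hx
  · have h : Set.EqOn (fun _ : ℝ => (0 : ℝ)) (fun t => min 0 t * t ^ (s - 2)) (Set.uIcc 0 M) :=
      fun t ht => by
        rw [Set.uIcc_of_le hM.le] at ht
        simp [min_eq_left ht.1]
    refine ⟨IntervalIntegrable.congr (h.mono Set.uIoc_subset_uIcc) (by simp), ?_⟩
    rw [← intervalIntegral.integral_congr h]
    simp [Real.zero_rpow hs0.ne']
  have h1 : Set.EqOn (fun t : ℝ => t ^ (s - 1)) (fun t => min x t * t ^ (s - 2))
      (Set.uIcc 0 x) := fun t ht => by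
    rw [Set.uIcc_of_le hx.le] at ht
    simp only [min_eq_right ht.2]
    rcases ht.1.eq_or_lt with rfl | h0
    · rw [Real.zero_rpow (by linarith), zero_mul]
    · rw [show s - 1 = (s - 2) + 1 by ring, Real.rpow_add_one h0.ne', mul_comm]
  have h2 : Set.EqOn (fun t : ℝ => x * t ^ (s - 2)) (fun t => min x t * t ^ (s - 2))
      (Set.uIcc x M) := fun t ht => by
    rw [Set.uIcc_of_le hxM] at ht
    simp [min_eq_left ht.1]
  have h0 : (0 : ℝ) ∉ Set.uIcc x M := by
    rw [Set.uIcc_of_le hxM]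
    exact fun h => hx.not_ge h.1
  have i1 : IntervalIntegrable (fun t => min x t * t ^ (s - 2)) MeasureTheory.volume 0 x :=
    (intervalIntegral.intervalIntegrable_rpow' (by linarith)).congr
      (h1.mono Set.uIoc_subset_uIcc)
  have i2 : IntervalIntegrable (fun t => min x t * t ^ (s - 2)) MeasureTheory.volume x M :=
    ((intervalIntegral.intervalIntegrable_rpow (Or.inr h0)).const_mul x).congr
      (h2.mono Set.uIoc_subset_uIcc)
  refine ⟨i1.trans i2, ?_⟩
  rw [← intervalIntegral.integral_add_adjacent_intervals i1 i2,
    ← intervalIntegral.integral_congr h1, ← intervalIntegral.integral_congr h2,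
    intervalIntegral.integral_const_mul, integral_rpow (Or.inl (by linarith)),
    integral_rpow (Or.inr ⟨by linarith, h0⟩), show s - 1 + 1 = s by ring,
    show s - 2 + 1 = s - 1 by ring, Real.zero_rpow hs0.ne', Real.rpow_sub_one hx.ne']
  have hs2 : s - 1 ≠ 0 := by linarith
  have hs3 : 1 - s ≠ 0 := by linarith
  rw [show s - 1 = -(1 - s) by ring]
  field_simp
  ring

theorem sum_rpow_le_of_sum_min_le {k : ℕ} {a b c : ℕ → ℝ} (ha : ∀ i, 0 ≤ a i)
    (hb : ∀ i, 0 ≤ b i) (hc : ∀ i, 0 ≤ c i)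
    (h : ∀ t, 0 ≤ t → ∑ i ∈ Finset.range k, min (c i) t ≤
      ∑ i ∈ Finset.range k, min (a i) t + ∑ i ∈ Finset.range k, min (b i) t)
    {s : ℝ} (hs0 : 0 < s) (hs1 : s ≤ 1) :
    ∑ i ∈ Finset.range k, c i ^ s ≤
      ∑ i ∈ Finset.range k, a i ^ s + ∑ i ∈ Finset.range k, b i ^ s := by
  set M : ℝ := 1 + ∑ i ∈ Finset.range k, (a i + b i + c i) with hM_def
  have hle : ∀ i ∈ Finset.range k, a i + b i + c i ≤ M := fun i hi => by
    have := Finset.single_le_sum (f := fun i => a i + b i + c i)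
      (fun j _ => add_nonneg (add_nonneg (ha j) (hb j)) (hc j)) hi
    linarith
  have hM : 0 < M := by
    have := Finset.sum_nonneg (s := Finset.range k) (f := fun i => a i + b i + c i)
      (fun j _ => add_nonneg (add_nonneg (ha j) (hb j)) (hc j))
    linarith
  have haM : ∀ i ∈ Finset.range k, a i ≤ M := fun i hi => by linarith [hle i hi, hb i, hc i]
  have hbM : ∀ i ∈ Finset.range k, b i ≤ M := fun i hi => by linarith [hle i hi, ha i, hc i]
  have hcM : ∀ i ∈ Finset.range k, c i ≤ M := fun i hi => by linarith [hle i hi, hb i, ha i]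
  -- At t = M no truncation takes effect. This inequality cancels the linear terms of the integral
  -- formula, and for s = 1 it is already the claim.
  have hlin : ∑ i ∈ Finset.range k, c i ≤
      ∑ i ∈ Finset.range k, a i + ∑ i ∈ Finset.range k, b i := by
    have := h M hM.le
    rwa [Finset.sum_congr rfl fun i hi => min_eq_left (hcM i hi),
      Finset.sum_congr rfl fun i hi => min_eq_left (haM i hi),
      Finset.sum_congr rfl fun i hi => min_eq_left (hbM i hi)] at this
  rcases hs1.eq_or_lt with rfl | hs1
  · simpa using hlin
  have key : ∀ d : ℕ → ℝ, (∀ i, 0 ≤ d i) → (∀ i ∈ Finset.range k, d i ≤ M) →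
      IntervalIntegrable (fun t => ∑ i ∈ Finset.range k, min (d i) t * t ^ (s - 2))
        MeasureTheory.volume 0 M ∧
      ∫ t in (0 : ℝ)..M, ∑ i ∈ Finset.range k, min (d i) t * t ^ (s - 2) =
        (1 / s + 1 / (1 - s)) * ∑ i ∈ Finset.range k, d i ^ s -
          M ^ (s - 1) / (1 - s) * ∑ i ∈ Finset.range k, d i := fun d hd hdM => by
    have hI := fun i hi => intervalIntegral_min_mul_rpow hs0 hs1 (hd i) (hdM i hi) hM
    refine ⟨?_, ?_⟩
    · have h1 := IntervalIntegrable.sum (Finset.range k) fun i hi => (hI i hi).1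
      have h2 : (fun t => ∑ i ∈ Finset.range k, min (d i) t * t ^ (s - 2)) =
          ∑ i ∈ Finset.range k, fun t => min (d i) t * t ^ (s - 2) := by
        funext t
        simp
      rw [h2]
      exact h1
    · rw [intervalIntegral.integral_finsetSum fun i hi => (hI i hi).1,
        Finset.sum_congr rfl fun i hi => (hI i hi).2, Finset.sum_sub_distrib, Finset.mul_sum,
        Finset.mul_sum]
  obtain ⟨ia, ea⟩ := key a ha haM
  obtain ⟨ib, eb⟩ := key b hb hbM
  obtain ⟨ic, ec⟩ := key c hc hcM
  have hint := intervalIntegral.integral_mono_on hM.le ic (ia.add ib) fun t ht => by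
    rw [← Finset.sum_mul, ← Finset.sum_mul, ← Finset.sum_mul, ← add_mul]
    exact mul_le_mul_of_nonneg_right (h t ht.1) (Real.rpow_nonneg ht.1 _)
  rw [intervalIntegral.integral_add ia ib, ea, eb, ec] at hint
  have h1 : 0 ≤ M ^ (s - 1) / (1 - s) := div_nonneg (Real.rpow_nonneg hM.le _) (by linarith)
  have h2 : 0 < 1 / s + 1 / (1 - s) := by
    have : 0 < 1 - s := by linarith
    positivity
  have h3 := mul_le_mul_of_nonneg_left hlin h1
  refine le_of_mul_le_mul_left ?_ h2
  linarith

/-- The entries exceeding t form an initial block because the sequence decreases; p is its length.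
-/
theorem exists_sum_min_eq {a : ℕ → ℝ} (ha : Antitone a) (t : ℝ) (k : ℕ) :
    ∃ p ≤ k, ∑ i ∈ Finset.range k, min (a i) t = p * t + ∑ i ∈ Finset.Ico p k, a i := by
  induction k with
  | zero => exact ⟨0, le_rfl, by simp⟩
  | succ k ih =>
    rcases le_total (a k) t with h | h
    · obtain ⟨p, hp, hsum⟩ := ih
      refine ⟨p, hp.trans k.le_succ, ?_⟩
      rw [Finset.sum_range_succ, hsum, Finset.sum_Ico_succ_top hp, min_eq_left h, add_assoc]
    · refine ⟨k + 1, le_rfl, ?_⟩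
      rw [Finset.sum_congr rfl fun i hi => min_eq_right
        (h.trans (ha (Nat.lt_succ_iff.1 (Finset.mem_range.1 hi))))]
      simp

/-- With p and q the cut positions of a and b, the first p + q terms for c are at most t each, and
the tail hypothesis bounds the rest. -/
theorem sum_min_le_of_sum_Ico_le {k : ℕ} {a b c : ℕ → ℝ} (ha : Antitone a) (hb : Antitone b)
    (ha0 : ∀ i, 0 ≤ a i) (hb0 : ∀ i, 0 ≤ b i)
    (h : ∀ p q, p + q ≤ k → ∑ i ∈ Finset.Ico (p + q) k, c i ≤
      ∑ i ∈ Finset.Ico p k, a i + ∑ i ∈ Finset.Ico q k, b i) {t : ℝ} (ht : 0 ≤ t) :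
    ∑ i ∈ Finset.range k, min (c i) t ≤
      ∑ i ∈ Finset.range k, min (a i) t + ∑ i ∈ Finset.range k, min (b i) t := by
  obtain ⟨p, -, hpa⟩ := exists_sum_min_eq ha t k
  obtain ⟨q, -, hqb⟩ := exists_sum_min_eq hb t k
  rw [hpa, hqb]
  have ha' : 0 ≤ ∑ i ∈ Finset.Ico p k, a i := Finset.sum_nonneg fun i _ => ha0 i
  have hb' : 0 ≤ ∑ i ∈ Finset.Ico q k, b i := Finset.sum_nonneg fun i _ => hb0 i
  rcases le_total (p + q) k with hk | hk
  · rw [← Finset.sum_range_add_sum_Ico _ hk]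
    have h1 : ∑ i ∈ Finset.range (p + q), min (c i) t ≤ (p + q : ℕ) * t := by
      refine (Finset.sum_le_sum fun i _ => min_le_right (c i) t).trans_eq ?_
      simp
    have h2 : ∑ i ∈ Finset.Ico (p + q) k, min (c i) t ≤ ∑ i ∈ Finset.Ico (p + q) k, c i :=
      Finset.sum_le_sum fun i _ => min_le_left (c i) t
    have h3 := h p q hk
    push_cast at h1
    linarith
  · have h1 : ∑ i ∈ Finset.range k, min (c i) t ≤ k * t := by
      refine (Finset.sum_le_sum fun i _ => min_le_right (c i) t).trans_eq ?_
      simp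
    have h2 : (k : ℝ) * t ≤ (p + q : ℕ) * t := by gcongr
    push_cast at h2
    linarith

end PowerSums

/-! ### The inequalities of Ky Fan and Rotfel'd -/

section Rotfeld

open Submodule

variable {H : Type*} [NormedAddCommGroup H] [InnerProductSpace ℂ H] [CompleteSpace H]

/-- Ky Fan's inequality. -/
theorem GelfandCompact.sum_gelfandNumber_add_le {X Y : H →L[ℂ] H} (hc : GelfandCompact (X + Y))
    (n : ℕ) : ∑ i ∈ Finset.range n, gelfandNumber (X + Y) i ≤
      ∑ i ∈ Finset.range n, gelfandNumber X i + ∑ i ∈ Finset.range n, gelfandNumber Y i := by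
  induction n with
  | zero => simp
  | succ n ih =>
    -- A vanishing last term reduces to the induction hypothesis. Otherwise all the numbers are
    -- positive and can be divided by.
    rcases (gelfandNumber_nonneg (X + Y) n).eq_or_lt with h0 | hpos
    · rw [Finset.sum_range_succ, ← h0, Finset.sum_range_succ, Finset.sum_range_succ]
      linarith [gelfandNumber_nonneg X n, gelfandNumber_nonneg Y n]
    set D := X + Y with hD
    have hpos' : ∀ i < n + 1, 0 < gelfandNumber D i := fun i hi =>
      hpos.trans_le (gelfandNumber_antitone D (Nat.lt_succ_iff.1 hi))
    have hcD : GelfandCompact (CFC.abs D) := by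
      rw [GelfandCompact, gelfandNumber_cfcAbs]
      exact hc
    obtain ⟨e, he, heD⟩ := hcD.exists_orthonormal_eigenvectors (CFC.abs_nonneg D) (n := n + 1)
      (by simpa only [gelfandNumber_cfcAbs] using hpos')
    rw [gelfandNumber_cfcAbs] at heD
    have hinner : ∀ i j, inner ℂ (D (e i)) (D (e j)) =
        (gelfandNumber D i * gelfandNumber D j : ℂ) * inner ℂ (e i) (e j) := fun i j => by
      rw [← inner_cfcAbs_apply, heD, heD, inner_smul_left, inner_smul_right, Complex.conj_ofReal,
        mul_assoc]
    -- The left Schmidt vectors of D: paired with D e_i they give exactly the Gelfand numbers, so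
    -- the trace bound can be applied to X and Y separately.
    let f : Fin (n + 1) → H := fun i => ((gelfandNumber D i : ℂ)⁻¹) • D (e i)
    have hne : ∀ i : Fin (n + 1), (gelfandNumber D i : ℂ) ≠ 0 := fun i => by
      exact_mod_cast (hpos' i i.2).ne'
    have hf : Orthonormal ℂ f := by
      rw [orthonormal_iff_ite]
      intro i j
      simp only [f]
      rw [inner_smul_left, inner_smul_right, hinner, (orthonormal_iff_ite.1 he i j), map_inv₀,
        Complex.conj_ofReal]
      split_ifs with hij
      · subst hij
        have := hne i
        field_simp
      · simp
    have hfD : ∀ i, inner ℂ (f i) (D (e i)) = (gelfandNumber D i : ℂ) := fun i => by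
      simp only [f]
      rw [inner_smul_left, hinner, (orthonormal_iff_ite.1 he i i), map_inv₀, Complex.conj_ofReal]
      have := hne i
      simp only [if_true]
      field_simp
    have h1 := re_sum_inner_le_sum_gelfandNumber X he hf
    have h2 := re_sum_inner_le_sum_gelfandNumber Y he hf
    rw [Finset.sum_range, Finset.sum_range, Finset.sum_range]
    refine le_trans (le_of_eq ?_) (add_le_add h1 h2)
    rw [← Complex.add_re, ← Finset.sum_add_distrib]
    have h3 : ∀ i, inner ℂ (f i) (X (e i)) + inner ℂ (f i) (Y (e i)) =
        (gelfandNumber D i : ℂ) := fun i => by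
      rw [← inner_add_right, ← hfD i, hD, add_apply]
    rw [Finset.sum_congr rfl fun i _ => h3 i, Complex.re_sum]
    simp

theorem GelfandCompact.exists_submodule_gelfandNumber_mul_le {A : H →L[ℂ] H}
    (hA : GelfandCompact A) (p : ℕ) : ∃ V : Submodule ℂ H, ∃ _ : FiniteDimensional ℂ V,
      Module.finrank ℂ V ≤ p ∧
        ∀ i, gelfandNumber (A * Vᗮ.starProjection) i ≤ gelfandNumber A (i + p) := by
  have hc : GelfandCompact (CFC.abs A) := by
    rw [GelfandCompact, gelfandNumber_cfcAbs]
    exact hA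
  obtain ⟨V, hV, hVp, h⟩ := hc.exists_submodule_gelfandNumber_le (CFC.abs_nonneg A) p
  refine ⟨V, hV, hVp, fun i => ?_⟩
  rw [← gelfandNumber_cfcAbs A, gelfandNumber_congr (B := CFC.abs A * Vᗮ.starProjection)]
  · exact h i
  · intro x
    exact (norm_cfcAbs_apply A _).symm

/-- Multiplying by the projection Q away from p leading directions of A and q of B shifts their
indices by p and q, and costs A + B at most p + q indices. Ky Fan's inequality for A Q + B Q does
the rest. -/
theorem sum_Ico_gelfandNumber_add_le {A B : H →L[ℂ] H} (hA : GelfandCompact A)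
    (hB : GelfandCompact B) {p q k : ℕ} (hk : p + q ≤ k) :
    ∑ i ∈ Finset.Ico (p + q) k, gelfandNumber (A + B) i ≤
      ∑ i ∈ Finset.Ico p k, gelfandNumber A i + ∑ i ∈ Finset.Ico q k, gelfandNumber B i := by
  obtain ⟨V, hV, hVp, hVA⟩ := hA.exists_submodule_gelfandNumber_mul_le p
  obtain ⟨W, hW, hWq, hWB⟩ := hB.exists_submodule_gelfandNumber_mul_le q
  set Q := (V ⊔ W)ᗮ.starProjection with hQ
  have hQ1 : ‖Q‖ ≤ 1 := starProjection_norm_le _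
  have hVQ : Vᗮ.starProjection * Q = Q := by
    ext x
    exact starProjection_eq_self_iff.2 (orthogonal_le le_sup_left (starProjection_apply_mem _ x))
  have hWQ : Wᗮ.starProjection * Q = Q := by
    ext x
    exact starProjection_eq_self_iff.2 (orthogonal_le le_sup_right (starProjection_apply_mem _ x))
  have hAQ : ∀ i, gelfandNumber (A * Q) i ≤ gelfandNumber A (i + p) := fun i => by
    refine le_trans ?_ (hVA i)
    rw [← hVQ, ← mul_assoc]
    exact gelfandNumber_mul_le _ _ hQ1 _
  have hBQ : ∀ i, gelfandNumber (B * Q) i ≤ gelfandNumber B (i + q) := fun i => by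
    refine le_trans ?_ (hWB i)
    rw [← hWQ, ← mul_assoc]
    exact gelfandNumber_mul_le _ _ hQ1 _
  have hC : ∀ i, gelfandNumber (A + B) (i + (p + q)) ≤ gelfandNumber (A * Q + B * Q) i :=
    fun i => gelfandNumber_add_le_of_eqOn (V ⊔ W)
      ((finrank_add_le_finrank_add_finrank V W).trans (add_le_add hVp hWq)) fun x hx => by
        have : Q x = x := starProjection_eq_self_iff.2 hx
        simp [this]
  have hKF := GelfandCompact.sum_gelfandNumber_add_le
    (show GelfandCompact (A * Q + B * Q) from
      (hA.mul_right Q hQ1).add (hB.mul_right Q hQ1)) (k - (p + q))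
  have hshift : ∀ (g : ℕ → ℝ) (m : ℕ), (∀ i, 0 ≤ g i) → m ≤ p + q →
      ∑ i ∈ Finset.range (k - (p + q)), g (i + m) ≤ ∑ i ∈ Finset.Ico m k, g i :=
    fun g m hg hm => by
      rw [Finset.sum_Ico_eq_sum_range]
      simp only [add_comm m]
      exact Finset.sum_le_sum_of_subset_of_nonneg
        (Finset.range_subset_range.2 (by omega)) fun i _ _ => hg _
  calc ∑ i ∈ Finset.Ico (p + q) k, gelfandNumber (A + B) i
      = ∑ i ∈ Finset.range (k - (p + q)), gelfandNumber (A + B) (i + (p + q)) := by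
        rw [Finset.sum_Ico_eq_sum_range]
        simp only [add_comm (p + q)]
    _ ≤ _ := Finset.sum_le_sum fun i _ => hC i
    _ ≤ _ := hKF
    _ ≤ _ := add_le_add
      ((Finset.sum_le_sum fun i _ => hAQ i).trans
        (hshift _ p (gelfandNumber_nonneg A) (Nat.le_add_right p q)))
      ((Finset.sum_le_sum fun i _ => hBQ i).trans
        (hshift _ q (gelfandNumber_nonneg B) (Nat.le_add_left q p)))

/-- Rotfel'd's inequality. -/
theorem sum_gelfandNumber_add_rpow_le {A B : H →L[ℂ] H} (hA : GelfandCompact A)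
    (hB : GelfandCompact B) (k : ℕ) {s : ℝ} (hs0 : 0 < s) (hs1 : s ≤ 1) :
    ∑ i ∈ Finset.range k, gelfandNumber (A + B) i ^ s ≤
      ∑ i ∈ Finset.range k, gelfandNumber A i ^ s +
        ∑ i ∈ Finset.range k, gelfandNumber B i ^ s :=
  sum_rpow_le_of_sum_min_le (gelfandNumber_nonneg A) (gelfandNumber_nonneg B)
    (gelfandNumber_nonneg _) (fun _ ht => sum_min_le_of_sum_Ico_le (gelfandNumber_antitone A)
      (gelfandNumber_antitone B) (gelfandNumber_nonneg A) (gelfandNumber_nonneg B)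
      (fun _ _ hpq => sum_Ico_gelfandNumber_add_le hA hB hpq) ht) hs0 hs1

theorem sum_gelfandNumber_sum_rpow_le {A : ℕ → H →L[ℂ] H} (hA : ∀ j, GelfandCompact (A j))
    (k N : ℕ) {s : ℝ} (hs0 : 0 < s) (hs1 : s ≤ 1) :
    ∑ i ∈ Finset.range k, gelfandNumber (∑ j ∈ Finset.range N, A j) i ^ s ≤
      ∑ j ∈ Finset.range N, ∑ i ∈ Finset.range k, gelfandNumber (A j) i ^ s := by
  induction N with
  | zero =>
    refine Finset.sum_nonpos fun i _ => ?_
    have : gelfandNumber (0 : H →L[ℂ] H) i = 0 :=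
      le_antisymm (by simpa using gelfandNumber_le_norm (0 : H →L[ℂ] H) i)
        (gelfandNumber_nonneg _ _)
    simp [this, Real.zero_rpow hs0.ne']
  | succ N ih =>
    rw [Finset.sum_range_succ, Finset.sum_range_succ]
    exact (sum_gelfandNumber_add_rpow_le (GelfandCompact.sum _ fun j _ => hA j) (hA N) k hs0
      hs1).trans (add_le_add ih le_rfl)

/-- The series is a partial sum plus a compact remainder R, which contributes at most k‖R‖^s → 0. -/
theorem sum_gelfandNumber_tsum_rpow_le {A : ℕ → H →L[ℂ] H} (hA : ∀ j, GelfandCompact (A j))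
    (hsum : Summable A) (k : ℕ) {s : ℝ} (hs0 : 0 < s) (hs1 : s ≤ 1)
    (hs : ∀ i, Summable fun j => gelfandNumber (A j) i ^ s) :
    ∑ i ∈ Finset.range k, gelfandNumber (∑' j, A j) i ^ s ≤
      ∑ i ∈ Finset.range k, ∑' j, gelfandNumber (A j) i ^ s := by
  have hR : Filter.Tendsto (fun N => ‖∑' j, A j - ∑ j ∈ Finset.range N, A j‖)
      Filter.atTop (𝓝 0) := by
    have := (tendsto_const_nhds (x := ∑' j, A j)).sub hsum.hasSum.tendsto_sum_nat
    simpa using this.norm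
  have hlim : Filter.Tendsto (fun N => ∑ i ∈ Finset.range k, ∑' j, gelfandNumber (A j) i ^ s +
      k * ‖∑' j, A j - ∑ j ∈ Finset.range N, A j‖ ^ s) Filter.atTop
      (𝓝 (∑ i ∈ Finset.range k, ∑' j, gelfandNumber (A j) i ^ s + k * 0 ^ s)) :=
    ((hR.rpow_const (Or.inr hs0.le)).const_mul _).const_add _
  rw [Real.zero_rpow hs0.ne', mul_zero, add_zero] at hlim
  refine ge_of_tendsto' hlim fun N => ?_
  set R := ∑' j, A j - ∑ j ∈ Finset.range N, A j with hRdef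
  have hcS : GelfandCompact (∑ j ∈ Finset.range N, A j) := GelfandCompact.sum _ fun j _ => hA j
  have hcR : GelfandCompact R := by
    have hsumN : Summable fun j => A (j + N) := (summable_nat_add_iff N).2 hsum
    have hR' : R = ∑' j, A (j + N) := by
      rw [hRdef, ← hsum.sum_add_tsum_nat_add N, add_sub_cancel_left]
    rw [hR']
    exact gelfandCompact_tsum hsumN fun j => hA (j + N)
  have h1 := sum_gelfandNumber_add_rpow_le hcS hcR k hs0 hs1
  rw [hRdef, add_sub_cancel, ← hRdef] at h1
  refine h1.trans (add_le_add ((sum_gelfandNumber_sum_rpow_le hA k N hs0 hs1).trans ?_) ?_)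
  · rw [Finset.sum_comm]
    exact Finset.sum_le_sum fun i _ => (hs i).sum_le_tsum _
      fun j _ => Real.rpow_nonneg (gelfandNumber_nonneg _ _) _
  · refine (Finset.sum_le_sum fun i _ => Real.rpow_le_rpow (gelfandNumber_nonneg R i)
      (gelfandNumber_le_norm R i) hs0.le).trans_eq ?_
    simp

end Rotfeld

/-! ### Symmetric norming functions: dominance, comparison with Φ_∞, countable subadditivity -/

namespace SymmetricNormingFunction

variable (Φ : SymmetricNormingFunction)

/-- The truncation `(ξ₀, …, ξ_{m-1}, 0, 0, …)`. -/
noncomputable abbrev truncate (m : ℕ) (ξ : ℕ → ℝ) : ℕ →₀ ℝ :=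
  Finsupp.indicator (Finset.range m) fun j _ => ξ j

theorem truncate_apply (m : ℕ) (ξ : ℕ → ℝ) (j : ℕ) :
    truncate m ξ j = if j < m then ξ j else 0 := by
  simp [truncate, Finsupp.indicator_apply]

theorem toFun_smul (a : ℝ) (ξ : ℕ →₀ ℝ) : Φ.toFun (a • ξ) = |a| * Φ.toFun ξ := by
  simpa using Φ.smul' a ξ

theorem toFun_nonneg (ξ : ℕ →₀ ℝ) : 0 ≤ Φ.toFun ξ := apply_nonneg Φ.toSeminorm ξ

theorem toFun_zero : Φ.toFun 0 = 0 := map_zero Φ.toSeminorm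

/-- Hahn–Banach. On truncations such a functional is a finite weighted sum, which reduces estimates
of Φ to estimates of sums. -/
theorem exists_support_functional (ξ : ℕ →₀ ℝ) :
    ∃ f : (ℕ →₀ ℝ) →ₗ[ℝ] ℝ, f ξ = Φ.toFun ξ ∧ ∀ ζ, f ζ ≤ Φ.toFun ζ := by
  by_cases h : ξ = 0
  · exact ⟨0, by simp [h, toFun_zero], fun ζ => Φ.toFun_nonneg ζ⟩
  obtain ⟨g, hg, hgN⟩ := exists_extension_of_le_sublinear
    (LinearPMap.mkSpanSingleton ξ (Φ.toFun ξ) h) Φ.toFun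
    (fun c hc x => by rw [toFun_smul, abs_of_pos hc]) Φ.add_le' (by
      rintro ⟨x, hx⟩
      obtain ⟨c, rfl⟩ := Submodule.mem_span_singleton.1 hx
      rw [LinearPMap.mkSpanSingleton'_apply, toFun_smul, RingHom.id_apply, smul_eq_mul]
      exact mul_le_mul_of_nonneg_right (le_abs_self c) (Φ.toFun_nonneg ξ))
  refine ⟨g, ?_, hgN⟩
  have h1 := hg ⟨ξ, Submodule.mem_span_singleton_self ξ⟩
  rw [h1]
  exact LinearPMap.mkSpanSingleton_apply ℝ ℝ h (Φ.toFun ξ)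

theorem map_truncate (f : (ℕ →₀ ℝ) →ₗ[ℝ] ℝ) (m : ℕ) (ξ : ℕ → ℝ) :
    f (truncate m ξ) = ∑ i ∈ Finset.range m, f (Finsupp.single i 1) * ξ i := by
  have h : truncate m ξ = ∑ i ∈ Finset.range m, ξ i • Finsupp.single i (1 : ℝ) := by
    ext j
    rw [truncate_apply, Finsupp.finsetSum_apply]
    simp [Finsupp.single_apply]
  rw [h, map_sum]
  exact Finset.sum_congr rfl fun i _ => by rw [map_smul, smul_eq_mul, mul_comm]

theorem truncate_eq_self {m : ℕ} {ξ : ℕ →₀ ℝ} (h : ∀ j, m ≤ j → ξ j = 0) :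
    truncate m ξ = ξ := by
  ext j
  rw [truncate_apply]
  split_ifs with hj
  · rfl
  · exact (h j (not_lt.1 hj)).symm

theorem exists_truncate_eq_self (ξ : ℕ →₀ ℝ) : ∃ m, truncate m ξ = ξ := by
  obtain ⟨m, hm⟩ := ξ.support.exists_nat_subset_range
  refine ⟨m, truncate_eq_self fun j hj => ?_⟩
  by_contra hne
  exact (Finset.mem_range.1 (hm (Finsupp.mem_support_iff.2 hne))).not_ge hj

/-- Abel summation, carried out as an induction on the stronger bound by u_k times the partial sum.
-/
theorem sum_mul_nonneg_of_partial_sums {u d : ℕ → ℝ} (hu : Antitone u) (hu0 : ∀ i, 0 ≤ u i)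
    {m : ℕ} (hd : ∀ k ≤ m, 0 ≤ ∑ i ∈ Finset.range k, d i) :
    0 ≤ ∑ i ∈ Finset.range m, u i * d i := by
  have key : ∀ k < m, u k * ∑ i ∈ Finset.range (k + 1), d i ≤
      ∑ i ∈ Finset.range (k + 1), u i * d i := fun k => by
    induction k with
    | zero => simp
    | succ k ih =>
      intro hk
      rw [Finset.sum_range_succ, Finset.sum_range_succ _ (k + 1), mul_add]
      have h1 := ih (by omega)
      have h2 := mul_le_mul_of_nonneg_right (hu k.le_succ) (hd (k + 1) hk.le)
      linarith
  cases m with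
  | zero => simp
  | succ m => exact (mul_nonneg (hu0 m) (hd _ le_rfl)).trans (key m m.lt_succ_self)

theorem exists_perm_antitone (m : ℕ) (w : ℕ → ℝ) : ∃ σ : Equiv.Perm ℕ,
    (∀ i, σ i < m ↔ i < m) ∧ (∀ i, m ≤ i → σ i = i) ∧
      ∀ i j, i ≤ j → j < m → w (σ j) ≤ w (σ i) := by
  let τ := Tuple.sort fun i : Fin m => - w i
  have hτ := Tuple.monotone_sort fun i : Fin m => - w i
  let σ := τ.extendDomain Fin.equivSubtype
  have hσ : ∀ i (hi : i < m), σ i = τ ⟨i, hi⟩ := fun i hi =>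
    τ.extendDomain_apply_image Fin.equivSubtype ⟨i, hi⟩
  have hσ' : ∀ i, m ≤ i → σ i = i := fun i hi =>
    τ.extendDomain_apply_not_subtype Fin.equivSubtype (not_lt.2 hi)
  refine ⟨σ, fun i => ?_, hσ', fun i j hij hj => ?_⟩
  · rcases lt_or_ge i m with hi | hi
    · simp [hσ i hi, hi]
    · simp [hσ' i hi]
  · rw [hσ i (hij.trans_lt hj), hσ j hj]
    exact neg_le_neg_iff.1 (hτ (show (⟨i, hij.trans_lt hj⟩ : Fin m) ≤ ⟨j, hj⟩ from hij))

theorem toFun_truncate_perm (m : ℕ) {σ : Equiv.Perm ℕ} (hσ : ∀ i, σ i < m ↔ i < m)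
    {ε y : ℕ → ℝ} (hε : ∀ i, |ε i| = 1) (hy : ∀ i, 0 ≤ y i) :
    Φ.toFun (truncate m fun j => ε j * y (σ.symm j)) = Φ.toFun (truncate m y) := by
  refine Φ.symmetric σ _ _ fun j => ?_
  rw [truncate_apply, truncate_apply]
  simp only [hσ]
  split_ifs
  · simp [abs_mul, hε, abs_of_nonneg (hy j)]
  · simp

theorem exists_sign (w : ℕ → ℝ) : ∃ ε : ℕ → ℝ, (∀ i, |ε i| = 1) ∧ ∀ i, w i * ε i = |w i| := by
  refine ⟨fun i => if 0 ≤ w i then 1 else -1, fun i => ?_, fun i => ?_⟩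
  · dsimp only
    split_ifs <;> simp
  · dsimp only
    split_ifs with h
    · simp [abs_of_nonneg h]
    · simp [abs_of_neg (not_le.1 h)]

/-- Ky Fan dominance: weak majorization of decreasing sequences is respected by `Φ`. -/
theorem toFun_truncate_le_of_partial_sums {m : ℕ} {x y : ℕ → ℝ} (hx : Antitone x)
    (hx0 : ∀ i, 0 ≤ x i) (hy0 : ∀ i, 0 ≤ y i)
    (h : ∀ k ≤ m, ∑ i ∈ Finset.range k, x i ≤ ∑ i ∈ Finset.range k, y i) :
    Φ.toFun (truncate m x) ≤ Φ.toFun (truncate m y) := by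
  obtain ⟨f, hfx, hfΦ⟩ := Φ.exists_support_functional (truncate m x)
  set w : ℕ → ℝ := fun i => f (Finsupp.single i 1) with hw
  obtain ⟨ε, hε, hwε⟩ := exists_sign w
  obtain ⟨σ, hσ, hσ', hanti⟩ := exists_perm_antitone m fun i => |w i|
  -- The absolute weights of the norming functional in decreasing order, continued by 0 so as to
  -- decrease on all of ℕ.
  let u : ℕ → ℝ := fun i => if i < m then |w (σ i)| else 0
  have hu0 : ∀ i, 0 ≤ u i := fun i => by
    dsimp only [u]
    split_ifs
    exacts [abs_nonneg _, le_rfl]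
  have hu : Antitone u := fun i j hij => by
    dsimp only [u]
    by_cases hj : j < m
    · rw [if_pos hj, if_pos (hij.trans_lt hj)]
      exact hanti i j hij hj
    · rw [if_neg hj]
      exact hu0 i
  have hperm : ∀ z : ℕ → ℝ, ∑ i ∈ Finset.range m, |w (σ i)| * z i =
      ∑ i ∈ Finset.range m, |w i| * z (σ.symm i) := fun z =>
    Finset.sum_equiv σ (fun i => by simp [hσ]) fun i _ => by simp
  have huz : ∀ z : ℕ → ℝ, ∑ i ∈ Finset.range m, u i * z i =
      ∑ i ∈ Finset.range m, |w (σ i)| * z i := fun z =>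
    Finset.sum_congr rfl fun i hi => by simp [u, Finset.mem_range.1 hi]
  calc Φ.toFun (truncate m x) = ∑ i ∈ Finset.range m, w i * x i := by rw [← hfx, map_truncate]
    _ ≤ ∑ i ∈ Finset.range m, |w i| * x i := Finset.sum_le_sum fun i _ =>
        mul_le_mul_of_nonneg_right (le_abs_self _) (hx0 i)
    _ = ∑ i ∈ Finset.range m, |w (σ (σ.symm i))| * x i := by simp
    -- Rearrangement inequality: as x decreases, pairing it with the decreasing weights gives the
    -- largest sum.
    _ ≤ ∑ i ∈ Finset.range m, |w (σ i)| * x i := by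
        refine MonovaryOn.sum_comp_perm_mul_le_sum_mul (f := fun i => |w (σ i)|) (σ := σ.symm)
          (fun i hi j hj hij => ?_) fun i hi => ?_
        · exact hanti j i (le_of_lt (by
            by_contra! hle
            exact (hx hle).not_gt hij)) (by simpa using hi)
        · by_contra hi'
          exact hi (σ.symm_apply_eq.2 (hσ' i (by simpa using hi')).symm)
    _ ≤ ∑ i ∈ Finset.range m, |w (σ i)| * y i := by
        rw [← huz, ← huz]
        have := sum_mul_nonneg_of_partial_sums (d := fun i => y i - x i) hu hu0 (m := m)
          fun k hk => by
            rw [Finset.sum_sub_distrib]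
            linarith [h k hk]
        simp only [mul_sub, Finset.sum_sub_distrib] at this
        linarith
    -- The sorting and the absolute values are moved from the weights onto y, where Φ does not see
    -- them.
    _ = f (truncate m fun j => ε j * y (σ.symm j)) := by
        rw [hperm, map_truncate]
        refine Finset.sum_congr rfl fun i _ => ?_
        rw [← mul_assoc, ← hwε]
    _ ≤ _ := hfΦ _
    _ = _ := Φ.toFun_truncate_perm m hσ hε hy0

theorem toFun_truncate_le_mul {m : ℕ} {x : ℕ → ℝ} {M : ℝ} (hM : 0 ≤ M) (h : ∀ i, |x i| ≤ M) :
    Φ.toFun (truncate m x) ≤ M * Φ.toFun (truncate m fun _ => 1) := by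
  obtain ⟨f, hfx, hfΦ⟩ := Φ.exists_support_functional (truncate m x)
  set w : ℕ → ℝ := fun i => f (Finsupp.single i 1) with hw
  obtain ⟨ε, hε, hwε⟩ := exists_sign w
  calc Φ.toFun (truncate m x) = ∑ i ∈ Finset.range m, w i * x i := by rw [← hfx, map_truncate]
    _ ≤ ∑ i ∈ Finset.range m, M * (w i * (ε i * 1)) := Finset.sum_le_sum fun i _ => by
        rw [mul_one, hwε, mul_comm M]
        refine (le_abs_self _).trans ?_
        rw [abs_mul]
        exact mul_le_mul_of_nonneg_left (h i) (abs_nonneg _)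
    _ = M * f (truncate m fun j => ε j * 1) := by rw [map_truncate, Finset.mul_sum]
    _ ≤ M * Φ.toFun (truncate m fun j => ε j * 1) := mul_le_mul_of_nonneg_left (hfΦ _) hM
    _ = _ := by
        rw [Φ.toFun_truncate_perm m (σ := 1) (y := fun _ => 1) (fun _ => Iff.rfl) hε
          fun _ => zero_le_one]

theorem toFun_single (j : ℕ) (a : ℝ) : Φ.toFun (Finsupp.single j a) = |a| := by
  have h1 : Φ.toFun (Finsupp.single j (1 : ℝ)) = 1 := by
    refine (Φ.symmetric (Equiv.swap 0 j) _ (Finsupp.single 0 1) fun i => ?_).trans Φ.normalized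
    by_cases hi : i = 0
    · simp [hi]
    · have h0 : Equiv.swap 0 j i ≠ j := fun h =>
        hi ((Equiv.swap 0 j).injective (h.trans (Equiv.swap_apply_left 0 j).symm))
      rw [Finsupp.single_eq_of_ne hi, Finsupp.single_eq_of_ne h0, abs_zero]
  have h2 : Finsupp.single j a = a • Finsupp.single j (1 : ℝ) := by
    rw [Finsupp.smul_single, smul_eq_mul, mul_one]
  rw [h2, toFun_smul, h1, mul_one]

/-- Flipping the signs of all entries but the j-th preserves Φ, and adding the original sequence
leaves only twice the j-th entry. -/
theorem abs_apply_le_toFun (ξ : ℕ →₀ ℝ) (j : ℕ) : |ξ j| ≤ Φ.toFun ξ := by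
  let ζ : ℕ →₀ ℝ := Finsupp.single j (2 * ξ j) - ξ
  have hζ : Φ.toFun ζ = Φ.toFun ξ := by
    have h : ∀ i, |ζ i| = |ξ i| := fun i => by
      by_cases hi : i = j
      · subst hi
        simp only [ζ, Finsupp.sub_apply, Finsupp.single_eq_same]
        congr 1
        ring
      · simp [ζ, Ne.symm hi]
    let η : ℕ →₀ ℝ := ξ.mapRange (fun t => |t|) abs_zero
    rw [Φ.symmetric 1 ζ η fun i => by simp [η, h], Φ.symmetric 1 ξ η fun i => by simp [η]]
  have h1 : ζ + ξ = Finsupp.single j (2 * ξ j) := by simp [ζ]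
  have h2 := Φ.add_le' ζ ξ
  change Φ.toFun (ζ + ξ) ≤ Φ.toFun ζ + Φ.toFun ξ at h2
  rw [h1, toFun_single, hζ, abs_mul, abs_two] at h2
  linarith

theorem equivalent_sup_of_bounded {B : ℝ} (h : ∀ n, Φ.toFun (truncate n fun _ => 1) ≤ B) :
    Φ.Equivalent sup := by
  have hsup : ∀ ξ : ℕ →₀ ℝ, sup.toFun ξ = ⨆ j, |ξ j| := fun _ => rfl
  refine ⟨⟨B, ?_⟩, ⟨1, ?_⟩⟩
  · rintro _ ⟨ξ, hξ, rfl⟩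
    have hpos : 0 < sup.toFun ξ :=
      (sup.toFun_nonneg ξ).lt_of_ne fun h0 => hξ (sup.definite ξ h0.symm)
    rw [div_le_iff₀ hpos]
    obtain ⟨m, hm⟩ := exists_truncate_eq_self ξ
    have h1 := Φ.toFun_truncate_le_mul (m := m) hpos.le
      fun i => le_ciSup (bddAbove_abs ξ) i
    rw [hm] at h1
    rw [mul_comm]
    exact h1.trans (mul_le_mul_of_nonneg_left (h m) hpos.le)
  · rintro _ ⟨ξ, hξ, rfl⟩
    exact div_le_one_of_le₀ (ciSup_le fun j => Φ.abs_apply_le_toFun ξ j) (Φ.toFun_nonneg ξ)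

theorem toFun_truncate_le_extend (ξ : ℕ → ℝ) (m : ℕ) :
    ENNReal.ofReal (Φ.toFun (truncate m ξ)) ≤ Φ.extend ξ :=
  le_iSup (fun m => ENNReal.ofReal (Φ.toFun (truncate m ξ))) m

theorem ofReal_le_extend (ξ : ℕ → ℝ) : ENNReal.ofReal (ξ 0) ≤ Φ.extend ξ := by
  refine le_trans (ENNReal.ofReal_le_ofReal ?_) (Φ.toFun_truncate_le_extend ξ 1)
  have := Φ.abs_apply_le_toFun (truncate 1 ξ) 0
  rw [truncate_apply, if_pos one_pos] at this
  exact (le_abs_self _).trans this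

/-- For decreasing ξ, ξ_n Φ(1,…,1) with n ones is at most Φ(ξ), while Φ(1,…,1) is unbounded by
`equivalent_sup_of_bounded`. -/
theorem tendsto_zero_of_extend_ne_top (hΦ : ¬ Φ.Equivalent sup) {ξ : ℕ → ℝ} (hξ : Antitone ξ)
    (hξ0 : ∀ i, 0 ≤ ξ i) (h : Φ.extend ξ ≠ ∞) : Filter.Tendsto ξ Filter.atTop (𝓝 0) := by
  rw [Metric.tendsto_atTop]
  intro ε hε
  have hB : ∀ m, Φ.toFun (truncate m ξ) ≤ (Φ.extend ξ).toReal := fun m =>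
    (ENNReal.ofReal_le_iff_le_toReal h).1 (Φ.toFun_truncate_le_extend ξ m)
  obtain ⟨n, hn⟩ : ∃ n, (Φ.extend ξ).toReal / ε < Φ.toFun (truncate n fun _ => 1) := by
    by_contra! hle
    exact hΦ (Φ.equivalent_sup_of_bounded hle)
  refine ⟨n, fun i hi => ?_⟩
  rw [Real.dist_eq, sub_zero, abs_of_nonneg (hξ0 i)]
  have h1 : ξ n * Φ.toFun (truncate n fun _ => 1) ≤ (Φ.extend ξ).toReal := by
    refine le_trans ?_ (hB n)
    have h2 : ξ n • truncate n (fun _ => 1) = truncate n fun _ => ξ n := by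
      ext j
      simp
    rw [← abs_of_nonneg (hξ0 n), ← toFun_smul, h2]
    exact Φ.toFun_truncate_le_of_partial_sums antitone_const (fun _ => hξ0 n) hξ0
      fun k hk => Finset.sum_le_sum fun i hi => hξ ((Finset.mem_range.1 hi).le.trans hk)
  rw [div_lt_iff₀ hε] at hn
  have hpos : 0 < Φ.toFun (truncate n fun _ => 1) := by
    by_contra! hle
    have := (ENNReal.toReal_nonneg (a := Φ.extend ξ))
    nlinarith
  refine (hξ hi).trans_lt (lt_of_mul_lt_mul_right (h1.trans_lt ?_) hpos.le)
  rwa [mul_comm ε]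

/-- Countable triangle inequality. A norming functional at the sum involves only m coordinates, so
it commutes with the series. -/
theorem ofReal_toFun_truncate_tsum_le {y : ℕ → ℕ → ℝ} (hs : ∀ i, Summable fun j => y j i)
    (m : ℕ) (hfin : ∑' j, Φ.extend (y j) ≠ ∞) :
    ENNReal.ofReal (Φ.toFun (truncate m fun i => ∑' j, y j i)) ≤ ∑' j, Φ.extend (y j) := by
  have hle : ∑' j, ENNReal.ofReal (Φ.toFun (truncate m (y j))) ≤ ∑' j, Φ.extend (y j) :=
    ENNReal.tsum_le_tsum fun j => Φ.toFun_truncate_le_extend _ m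
  have hsum : Summable fun j => Φ.toFun (truncate m (y j)) := by
    have := ENNReal.summable_toReal (ne_top_of_le_ne_top hfin hle)
    simpa [ENNReal.toReal_ofReal (Φ.toFun_nonneg _)] using this
  refine le_trans ?_ hle
  rw [← ENNReal.ofReal_tsum_of_nonneg (fun j => Φ.toFun_nonneg _) hsum]
  refine ENNReal.ofReal_le_ofReal ?_
  obtain ⟨f, hf, hfΦ⟩ := Φ.exists_support_functional (truncate m fun i => ∑' j, y j i)
  have hfs : HasSum (fun j => f (truncate m (y j))) (f (truncate m fun i => ∑' j, y j i)) := by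
    simp only [map_truncate]
    exact hasSum_sum fun i _ => (hs i).hasSum.mul_left _
  rw [← hf, ← hfs.tsum_eq]
  exact hfs.summable.tsum_le_tsum (fun j => hfΦ _) hsum

theorem extend_le_of_equivalent {B : ℝ} (hB0 : 0 ≤ B)
    (hB : ∀ ξ : ℕ →₀ ℝ, ξ ≠ 0 → Φ.toFun ξ / sup.toFun ξ ≤ B) {ξ : ℕ → ℝ} {M : ℝ} (hM : 0 ≤ M)
    (h : ∀ i, |ξ i| ≤ M) : Φ.extend ξ ≤ ENNReal.ofReal (B * M) := by
  refine iSup_le fun m => ENNReal.ofReal_le_ofReal ?_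
  change Φ.toFun (truncate m ξ) ≤ _
  by_cases h0 : truncate m ξ = 0
  · rw [h0, toFun_zero]
    positivity
  have hpos : 0 < sup.toFun (truncate m ξ) :=
    (sup.toFun_nonneg _).lt_of_ne fun h1 => h0 (sup.definite _ h1.symm)
  refine ((div_le_iff₀ hpos).1 (hB _ h0)).trans (mul_le_mul_of_nonneg_left ?_ hB0)
  refine ciSup_le fun j => ?_
  rw [truncate_apply]
  split_ifs
  · exact h j
  · simpa using hM

end SymmetricNormingFunction

/-! ### Powers of |A| and the two cases of the theorem -/

section Main

open SymmetricNormingFunction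

variable {H : Type*} [NormedAddCommGroup H] [InnerProductSpace ℂ H] [CompleteSpace H]

theorem gelfandNumber_rpow_le {T : H →L[ℂ] H} (hT : 0 ≤ T) {s : ℝ} (hs0 : 0 < s) (hs1 : s ≤ 1)
    (j : ℕ) : gelfandNumber (T ^ s) j ≤ gelfandNumber T j ^ s := by
  -- The infimum need not be attained and may be 0, so positive bounds t decrease to it and
  -- continuity of t^s is used.
  have hcont : Filter.Tendsto (fun t : ℝ => t ^ s) (𝓝[>] (gelfandNumber T j))
      (𝓝 (gelfandNumber T j ^ s)) :=
    ((Real.continuous_rpow_const hs0.le).tendsto _).mono_left nhdsWithin_le_nhds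
  refine ge_of_tendsto hcont (Filter.eventually_of_mem self_mem_nhdsWithin fun t ht => ?_)
  have ht0 : 0 < t := (gelfandNumber_nonneg T j).trans_lt ht
  obtain ⟨-, V, hV, hVj, hb⟩ := isGelfandBound_of_lt ht
  exact gelfandNumber_le ⟨Real.rpow_nonneg ht0.le s, V, hV, hVj,
    fun x hx => norm_rpow_apply_le hT hs0 hs1 ht0 (hb x hx)⟩

/-- The lower bound comes from the span of the first j + 1 eigenvectors, on which T^s is diagonal
with entries at least c_j(T)^s. -/
theorem GelfandCompact.gelfandNumber_rpow {T : H →L[ℂ] H} (hT : 0 ≤ T) (hc : GelfandCompact T)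
    {s : ℝ} (hs0 : 0 < s) (hs1 : s ≤ 1) (j : ℕ) :
    gelfandNumber (T ^ s) j = gelfandNumber T j ^ s := by
  refine le_antisymm (gelfandNumber_rpow_le hT hs0 hs1 j) ?_
  rcases (gelfandNumber_nonneg T j).eq_or_lt with h0 | hpos
  · rw [← h0, Real.zero_rpow hs0.ne']
    exact gelfandNumber_nonneg _ _
  have hpos' : ∀ i < j + 1, 0 < gelfandNumber T i := fun i hi =>
    hpos.trans_le (gelfandNumber_antitone T (Nat.lt_succ_iff.1 hi))
  obtain ⟨e, he, heT⟩ := hc.exists_orthonormal_eigenvectors hT hpos'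
  refine le_gelfandNumber_of_subspace (Submodule.span ℂ (Set.range e)) (fun _ => ?_) fun x hx => ?_
  · rw [finrank_span_eq_card he.linearIndependent, Fintype.card_fin]
    exact j.lt_succ_self
  obtain ⟨a, rfl⟩ := (Submodule.mem_span_range_iff_exists_fun ℂ).1 hx
  have hnorm : ∀ b : Fin (j + 1) → ℂ, ‖∑ i, b i • e i‖ ^ 2 = ∑ i, ‖b i‖ ^ 2 := fun b => by
    have h1 := he.inner_sum b b Finset.univ
    rw [inner_self_eq_norm_sq_to_K] at h1
    simp only [RCLike.conj_mul] at h1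
    exact_mod_cast h1
  have hTs : (T ^ s) (∑ i, a i • e i) =
      ∑ i, (a i * ((gelfandNumber T i ^ s : ℝ) : ℂ)) • e i := by
    rw [map_sum]
    refine Finset.sum_congr rfl fun i _ => ?_
    rw [map_smul, rpow_apply_of_apply_eq hT hs0 hs1 (hpos' i i.2) (heT i), smul_smul]
  refine le_of_sq_le_sq ?_ (norm_nonneg _)
  rw [mul_pow, hTs, hnorm, hnorm, Finset.mul_sum]
  refine Finset.sum_le_sum fun i _ => ?_
  have h2 := gelfandNumber_antitone T (Nat.lt_succ_iff.1 i.2)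
  have h3 := gelfandNumber_nonneg T j
  rw [norm_mul, Complex.norm_real, Real.norm_eq_abs,
    abs_of_nonneg (Real.rpow_nonneg (gelfandNumber_nonneg T i) s), mul_pow, mul_comm]
  gcongr

theorem GelfandCompact.of_cfcAbs_rpow {A : H →L[ℂ] H} {s : ℝ} (hs0 : 0 < s) (hs1 : s ≤ 1)
    (hc : GelfandCompact (CFC.abs A ^ s)) : GelfandCompact A := by
  refine hc.of_le (a := ‖CFC.abs A‖ ^ (1 - s)) fun j => ?_
  rw [← gelfandNumber_cfcAbs]
  exact gelfandNumber_le_of_norm_le (by positivity)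
    (norm_apply_le_rpow (CFC.abs_nonneg A) hs0 hs1) j

theorem opNorm_cfcAbs_rpow (Φ : SymmetricNormingFunction) (A : H →L[ℂ] H) (s : ℝ) :
    Φ.opNorm (CFC.abs A ^ s) = Φ.extend (gelfandNumber (CFC.abs A ^ s)) := by
  have h : 0 ≤ CFC.abs A ^ s := CFC.rpow_nonneg
  rw [SymmetricNormingFunction.opNorm, sNumber_of_nonneg h]

theorem norm_cfcAbs_rpow (A : H →L[ℂ] H) {s : ℝ} (hs0 : 0 < s) : ‖CFC.abs A ^ s‖ = ‖A‖ ^ s := by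
  rw [CFC.norm_rpow _ hs0 (CFC.abs_nonneg A), CFC.norm_abs]

theorem ofReal_norm_rpow_le_opNorm (Φ : SymmetricNormingFunction) (A : H →L[ℂ] H) {s : ℝ}
    (hs0 : 0 < s) : ENNReal.ofReal (‖A‖ ^ s) ≤ Φ.opNorm (CFC.abs A ^ s) := by
  rw [opNorm_cfcAbs_rpow, ← norm_cfcAbs_rpow A hs0, ← gelfandNumber_zero]
  exact Φ.ofReal_le_extend _

theorem opNorm_cfcAbs_rpow_of_compact (Φ : SymmetricNormingFunction) {A : H →L[ℂ] H} {s : ℝ}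
    (hs0 : 0 < s) (hs1 : s ≤ 1) (hc : GelfandCompact A) :
    Φ.opNorm (CFC.abs A ^ s) = Φ.extend fun i => gelfandNumber A i ^ s := by
  rw [opNorm_cfcAbs_rpow]
  congr 1
  funext i
  have hc' : GelfandCompact (CFC.abs A) := by
    rw [GelfandCompact, gelfandNumber_cfcAbs]
    exact hc
  rw [hc'.gelfandNumber_rpow (CFC.abs_nonneg A) hs0 hs1, gelfandNumber_cfcAbs]

theorem summable_norm_rpow (Φ : SymmetricNormingFunction) {A : ℕ → H →L[ℂ] H} {s : ℝ}
    (hs0 : 0 < s) (h : ∑' j, Φ.opNorm (CFC.abs (A j) ^ s) ≠ ∞) :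
    Summable fun j => ‖A j‖ ^ s := by
  have := ENNReal.summable_toReal (ne_top_of_le_ne_top h
    (ENNReal.tsum_le_tsum fun j => ofReal_norm_rpow_le_opNorm Φ (A j) hs0))
  refine this.congr fun j => ?_
  rw [ENNReal.toReal_ofReal (by positivity)]

/-- Eventually a_j ≤ 1, and then a_j ≤ a_j^s. -/
theorem summable_of_summable_rpow {a : ℕ → ℝ} (ha : ∀ j, 0 ≤ a j) {s : ℝ} (hs0 : 0 < s)
    (hs1 : s ≤ 1) (h : Summable fun j => a j ^ s) : Summable a := by
  refine h.of_norm_bounded_eventually_nat ?_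
  filter_upwards [h.tendsto_atTop_zero.eventually (Iio_mem_nhds one_pos)] with j hj
  have h1 : a j ≤ 1 := by
    by_contra! hlt
    exact (Real.one_le_rpow hlt.le hs0.le).not_gt hj
  rw [Real.norm_eq_abs, abs_of_nonneg (ha j)]
  simpa using Real.rpow_le_rpow_of_exponent_ge' (ha j) h1 hs0.le hs1

theorem tsum_rpow_le {a : ℕ → ℝ} (ha : ∀ j, 0 ≤ a j) {s : ℝ} (hs0 : 0 < s) (hs1 : s ≤ 1)
    (h : Summable fun j => a j ^ s) : (∑' j, a j) ^ s ≤ ∑' j, a j ^ s := by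
  have hlim := (summable_of_summable_rpow ha hs0 hs1 h).hasSum.tendsto_sum_nat.rpow_const
    (p := s) (Or.inr hs0.le)
  refine le_of_tendsto' hlim fun N => ?_
  refine le_trans ?_ (h.sum_le_tsum (Finset.range N) fun j _ => Real.rpow_nonneg (ha j) s)
  induction N with
  | zero => simp [Real.zero_rpow hs0.ne']
  | succ N ih =>
    rw [Finset.sum_range_succ, Finset.sum_range_succ]
    exact (Real.rpow_add_le_add_rpow (Finset.sum_nonneg fun j _ => ha j) (ha N) hs0.le hs1).trans
      (add_le_add ih le_rfl)

/-- If finiteness of `Φ` forces compactness, the inequality holds with constant `1`. -/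
theorem opNorm_tsum_rpow_le_of_not_equivalent {Φ : SymmetricNormingFunction}
    (hΦ : ¬ Φ.Equivalent sup) {s : ℝ} (hs0 : 0 < s) (hs1 : s ≤ 1) {A : ℕ → H →L[ℂ] H}
    (h : ∑' j, Φ.opNorm (CFC.abs (A j) ^ s) ≠ ∞) :
    Φ.opNorm (CFC.abs (∑' j, A j) ^ s) ≤ ∑' j, Φ.opNorm (CFC.abs (A j) ^ s) := by
  have hsum := summable_norm_rpow Φ hs0 h
  have hsumA : Summable A :=
    (summable_of_summable_rpow (fun j => norm_nonneg _) hs0 hs1 hsum).of_norm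
  have hc : ∀ j, GelfandCompact (A j) := fun j => by
    refine GelfandCompact.of_cfcAbs_rpow hs0 hs1 ?_
    have hj := ENNReal.ne_top_of_tsum_ne_top h j
    rw [opNorm_cfcAbs_rpow] at hj
    exact Φ.tendsto_zero_of_extend_ne_top hΦ (gelfandNumber_antitone _) (gelfandNumber_nonneg _) hj
  simp only [opNorm_cfcAbs_rpow_of_compact Φ hs0 hs1 (hc _)] at h ⊢
  rw [opNorm_cfcAbs_rpow_of_compact Φ hs0 hs1 (gelfandCompact_tsum hsumA hc)]
  have hs : ∀ i, Summable fun j => gelfandNumber (A j) i ^ s := fun i =>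
    hsum.of_nonneg_of_le (fun j => Real.rpow_nonneg (gelfandNumber_nonneg _ _) s)
      fun j => Real.rpow_le_rpow (gelfandNumber_nonneg _ _) (gelfandNumber_le_norm _ _) hs0.le
  refine iSup_le fun m => ?_
  refine le_trans (ENNReal.ofReal_le_ofReal ?_) (Φ.ofReal_toFun_truncate_tsum_le hs m h)
  -- Ky Fan dominance, whose majorization hypothesis is Rotfel'd's inequality for the series.
  refine Φ.toFun_truncate_le_of_partial_sums (fun i j hij => ?_)
    (fun i => Real.rpow_nonneg (gelfandNumber_nonneg _ _) s)
    (fun i => tsum_nonneg fun j => Real.rpow_nonneg (gelfandNumber_nonneg _ _) s)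
    fun k _ => sum_gelfandNumber_tsum_rpow_le hc hsumA k hs0 hs1 hs
  exact Real.rpow_le_rpow (gelfandNumber_nonneg _ _) (gelfandNumber_antitone _ hij) hs0.le

/-- Φ is at most B times the operator norm of the left-hand operator and at least the operator norm
of each term; subadditivity of x^s compares these norms. -/
theorem opNorm_tsum_rpow_le_of_bounded {Φ : SymmetricNormingFunction} {B : ℝ} (hB0 : 0 ≤ B)
    (hB : ∀ ξ : ℕ →₀ ℝ, ξ ≠ 0 → Φ.toFun ξ / sup.toFun ξ ≤ B) {s : ℝ} (hs0 : 0 < s) (hs1 : s ≤ 1)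
    {A : ℕ → H →L[ℂ] H} (h : ∑' j, Φ.opNorm (CFC.abs (A j) ^ s) ≠ ∞) :
    Φ.opNorm (CFC.abs (∑' j, A j) ^ s) ≤
      ENNReal.ofReal B * ∑' j, Φ.opNorm (CFC.abs (A j) ^ s) := by
  have hsum := summable_norm_rpow Φ hs0 h
  have hsumA := summable_of_summable_rpow (fun j => norm_nonneg (A j)) hs0 hs1 hsum
  have h1 : Φ.opNorm (CFC.abs (∑' j, A j) ^ s) ≤
      ENNReal.ofReal (B * ‖CFC.abs (∑' j, A j) ^ s‖) := by
    rw [opNorm_cfcAbs_rpow]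
    refine Φ.extend_le_of_equivalent hB0 hB (norm_nonneg _) fun i => ?_
    rw [abs_of_nonneg (gelfandNumber_nonneg _ _)]
    exact gelfandNumber_le_norm _ _
  have h2 : ‖∑' j, A j‖ ^ s ≤ ∑' j, ‖A j‖ ^ s :=
    (Real.rpow_le_rpow (norm_nonneg _) (norm_tsum_le_tsum_norm hsumA) hs0.le).trans
      (tsum_rpow_le (fun j => norm_nonneg _) hs0 hs1 hsum)
  refine h1.trans ?_
  rw [norm_cfcAbs_rpow _ hs0, ENNReal.ofReal_mul hB0]
  refine mul_le_mul_right ?_ _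
  refine (ENNReal.ofReal_le_ofReal h2).trans ?_
  rw [ENNReal.ofReal_tsum_of_nonneg (fun j => by positivity) hsum]
  exact ENNReal.tsum_le_tsum fun j => ofReal_norm_rpow_le_opNorm Φ (A j) hs0

end Main

theorem proposition5p5 (Φ : SymmetricNormingFunction) :
    ∃ C : ℝ, 0 < C ∧ (¬ Φ.Equivalent SymmetricNormingFunction.sup → C = 1) ∧
      ∀ (H : Type*) [NormedAddCommGroup H] [InnerProductSpace ℂ H] [CompleteSpace H]
        [TopologicalSpace.SeparableSpace H] (s : ℝ) (_ : 0 < s) (_ : s ≤ 1)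
        (A : ℕ → H →L[ℂ] H),
        ((∑' j, Φ.opNorm (CFC.abs (A j) ^ s)) ≠ ∞ → Summable fun j => ‖A j‖) ∧
        Φ.opNorm (CFC.abs (∑' j, A j) ^ s) ≤
          ENNReal.ofReal (C * (2 : ℝ) ^ (1 - s)) * ∑' j, Φ.opNorm (CFC.abs (A j) ^ s) := by
  by_cases hΦ : Φ.Equivalent SymmetricNormingFunction.sup
  · obtain ⟨B, hB⟩ := hΦ.1
    have hB1 : ∀ ξ : ℕ →₀ ℝ, ξ ≠ 0 →
        Φ.toFun ξ / SymmetricNormingFunction.sup.toFun ξ ≤ max B 1 :=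
      fun ξ hξ => (hB ⟨ξ, hξ, rfl⟩).trans (le_max_left B 1)
    -- The maximum with 1 secures a positive constant, which also makes its product with ∞ equal to
    -- ∞ in the trivial case.
    have hC : 0 < max B 1 := one_pos.trans_le (le_max_right B 1)
    refine ⟨max B 1, hC, fun h => (h hΦ).elim, fun H _ _ _ _ s hs0 hs1 A =>
      ⟨fun h => summable_of_summable_rpow (fun j => norm_nonneg _) hs0 hs1
        (summable_norm_rpow Φ hs0 h), ?_⟩⟩
    have h2 : max B 1 ≤ max B 1 * (2 : ℝ) ^ (1 - s) :=
      le_mul_of_one_le_right hC.le (Real.one_le_rpow one_le_two (by linarith))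
    by_cases h : (∑' j, Φ.opNorm (CFC.abs (A j) ^ s)) = ∞
    · rw [h, ENNReal.mul_top (ENNReal.ofReal_pos.2 (hC.trans_le h2)).ne']
      exact le_top
    · exact (opNorm_tsum_rpow_le_of_bounded hC.le hB1 hs0 hs1 h).trans
        (mul_le_mul_left (ENNReal.ofReal_le_ofReal h2) _)
  · refine ⟨1, one_pos, fun _ => rfl, fun H _ _ _ _ s hs0 hs1 A =>
      ⟨fun h => summable_of_summable_rpow (fun j => norm_nonneg _) hs0 hs1
        (summable_norm_rpow Φ hs0 h), ?_⟩⟩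
    have h2 : 1 ≤ ENNReal.ofReal (1 * (2 : ℝ) ^ (1 - s)) := by
      rw [one_mul, ENNReal.one_le_ofReal]
      exact Real.one_le_rpow one_le_two (by linarith)
    by_cases h : (∑' j, Φ.opNorm (CFC.abs (A j) ^ s)) = ∞
    · rw [h, ENNReal.mul_top (one_pos.trans_le h2).ne']
      exact le_top
    · exact (opNorm_tsum_rpow_le_of_not_equivalent hΦ hs0 hs1 h).trans
        (le_mul_of_one_le_left (zero_le) h2)
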